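/- Let $1\le m\le L$ be integers and let $g,f$ be probability density functions on $\mathbb R$. Consider a homogeneous network of $L$ sensors producing observation vectors $X[k]=(X_1[k],\dots,X_L[k])\in\mathbb R^L$, $k\ge 1$, with filtration $\mathscr F_k=\sigma(X[1],\dots,X[k])$ ($\mathscr F_0$ trivial). Let $\mathcal E$ be the set of all subsets $E\subseteq\{1,\dots,L\}$ with $|E|=m$; write $g(x)=\prod_{\ell=1}^L g(x_\ell)$ and $p_E(x)=\prod_{\ell\in E}f(x_\ell)\prod_{\ell\notin E}g(x_\ell)$ for $x\in\mathbb R^L$. For a changepoint $\nu\ge 0$ and a deterministic anomaly path $S=(S[k])_{k\ge1}$ with $S[k]\in\mathcal E$, let $\mathbb P_\nu^{S}$ be the law under which the $X[k]$ are independent with density $g$ for $1\le k\le\nu$ and density $p_{S[k]}$ for $k>\nu$; let $\mathbb P_\infty$ be the law under which all $X[k]$ are i.i.d. with density $g$. For a stopping time $\tau$ of $(\mathscr F_k)$ with values in $\{1,2,\dots\}\cup\{\infty\}$ put $$\mathrm{WADD}(\tau)=\sup_{S}\ \sup_{\nu\ge0}\ \operatorname{ess\,sup}\ \mathbb E_\nu^{S}\left[\tau-\nu\mid\tau>\nu,\mathscr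 F_\nu\right],$$ where the conditional expectation is read as $1$ if $\mathbb P_\nu^{S}(\tau>\nu)=0$, and for $\gamma>1$ let $\mathcal C_\gamma$ be the set of such stopping times with $\mathbb E_\infty[\tau]\ge\gamma$. The M-CUSUM test with uniform weights $\lambda_U=\left(1/\binom Lm\right)_{E\in\mathcal E}$ and threshold $b>0$ is $$\tau_W(\lambda_U,b)=\inf\{k\ge1: W[k]\ge e^b\},\qquad W[k]=\max_{1\le i\le k}\ \prod_{j=i}^k\frac{\binom Lm^{-1}\sum_{E\in\mathcal E}p_E(X[j])}{g(X[j])}$$ (with $\inf\emptyset=\infty$, and with the ratio equal to $+\infty$ where only its denominator vanishes). **Theorem 2.** Let $\gamma>1$, and let $b>0$ be such that $\mathbb E_\infty[\tau_W(\lambda_U,b)]=\gamma$. Then $\tau_W(\lambda_U,b)$ is exactly optimal for the problem of minimizing $\mathrm{WADD}(\tau)$ over $\tau\in\mathcal C_\gamma$: it belongs to $\mathcal C_\gamma$, and $$\mathrm{WADD}(\tau_W(\lambda_U,b))=\inf_{\tau\in\mathcal C_\gamma}\mathrm{WADD}(\tau).$$ -/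

import Mathlib

open MeasureTheory ProbabilityTheory
open scoped ENNReal

namespace MovingAnomaly

noncomputable section

/-- A probability density function on the real line (with respect to Lebesgue measure). -/
structure IsPdf (p : ℝ → ℝ) : Prop where
  measurable : Measurable p
  nonneg : ∀ x, 0 ≤ p x
  lintegral_eq_one : ∫⁻ x, ENNReal.ofReal (p x) = 1

/-- The sample space of observation sequences of a network of `L` sensors.
The coordinate `ω n` is the observation vector at time `n + 1`, i.e. `X[n+1]`, so that the
observations up to and including time `k` are the coordinates `ω n` with `n < k`. -/
abbrev Obs (L : ℕ) : Type := ℕ → Fin L → ℝ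

/-- The possible placements of an anomaly of size `m` among `L` sensors. -/
abbrev Placement (L m : ℕ) : Type := {E : Finset (Fin L) // E.card = m}

/-- The filtration generated by the observations: at time `k` it is generated by
`X[1], …, X[k]`; it is trivial at time `0`. -/
def obsFiltration (L : ℕ) : Filtration ℕ (inferInstance : MeasurableSpace (Obs L)) where
  seq k := ⨆ n : ℕ, ⨆ _ : n < k, MeasurableSpace.comap (fun ω : Obs L => ω n) inferInstance
  mono' _ _ hij := iSup_mono fun _ => iSup_mono' fun hn => ⟨hn.trans_le hij, le_rfl⟩
  le' _ := iSup_le fun n => iSup_le fun _ => (measurable_pi_apply n).comap_le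

section Model

variable {L m : ℕ} (g f : Fin L → ℝ → ℝ)

/-- The joint density of an observation vector when no anomaly is present. -/
def preDensity (x : Fin L → ℝ) : ℝ≥0∞ := ∏ ℓ, ENNReal.ofReal (g ℓ (x ℓ))

/-- The joint density `p_E` of an observation vector when the anomalous sensors are those
in `E`. -/
def postDensity (E : Placement L m) (x : Fin L → ℝ) : ℝ≥0∞ :=
  (∏ ℓ ∈ E.1, ENNReal.ofReal (f ℓ (x ℓ))) * ∏ ℓ ∈ E.1ᶜ, ENNReal.ofReal (g ℓ (x ℓ))

/-- The law `ℙ_∞` of the observations when no anomaly ever appears. -/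
def noChangeLaw : Measure (Obs L) :=
  Measure.infinitePi fun _ : ℕ => volume.withDensity (preDensity g)

/-- The law `ℙ_ν^S` of the observations with changepoint `ν` and anomaly path `S`: the vectors
`X[k]` are independent, with density `g` for `k ≤ ν` and `p_{S[k]}` for `k > ν`.
As for the observations, `S n` is the placement at time `n + 1`. -/
def changeLaw (ν : ℕ) (S : ℕ → Placement L m) : Measure (Obs L) :=
  Measure.infinitePi fun n : ℕ =>
    volume.withDensity (if n + 1 ≤ ν then preDensity g else postDensity g f (S n))

/-- The essential supremum of `𝔼_ν^S[τ - ν | τ > ν, ℱ_ν]`, with value `1` if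
`ℙ_ν^S(τ > ν) = 0`. As the event `{τ > ν}` belongs to `ℱ_ν`, the conditional expectation given
this event and `ℱ_ν` is the conditional expectation given `ℱ_ν`, considered on this event. -/
def condDelay (τ : Obs L → ℕ∞) (ν : ℕ) (S : ℕ → Placement L m) : ℝ≥0∞ :=
  open Classical in
  if changeLaw g f ν S {ω | (ν : ℕ∞) < τ ω} = 0 then 1
  else essSup ((changeLaw g f ν S)⁻[fun ω => (τ ω : ℝ≥0∞) - (ν : ℝ≥0∞) | obsFiltration L ν])
    ((changeLaw g f ν S).restrict {ω | (ν : ℕ∞) < τ ω})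

/-- The worst-path worst average detection delay (`m` is the size of the anomaly). -/
def WADD (m : ℕ) (τ : Obs L → ℕ∞) : ℝ≥0∞ :=
  ⨆ (S : ℕ → Placement L m) (ν : ℕ), condDelay g f τ ν S

/-- The mean time to false alarm `𝔼_∞[τ]`. -/
def MTFA (τ : Obs L → ℕ∞) : ℝ≥0∞ := ∫⁻ ω, (τ ω : ℝ≥0∞) ∂(noChangeLaw g)

/-- The class `𝒞_γ` of all (positive, possibly infinite) stopping times of the observation
filtration whose mean time to false alarm is at least `γ`. -/
def stoppingClass (γ : ℝ) : Set (Obs L → ℕ∞) :=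
  {τ | IsStoppingTime (obsFiltration L) τ ∧ (∀ ω, 1 ≤ τ ω) ∧ ENNReal.ofReal γ ≤ MTFA g τ}

/-- The one-step likelihood ratio of the mixture density `∑_E w_E p_E` against the pre-change
density. It takes the value `∞` where only the latter vanishes. -/
def mixtureRatio (w : Placement L m → ℝ) (x : Fin L → ℝ) : ℝ≥0∞ :=
  (∑ E, ENNReal.ofReal (w E) * postDensity g f E x) / preDensity g x

/-- The M-CUSUM statistic `W_w[k] = max_{1 ≤ i ≤ k} ∏_{j=i}^k (mixture ratio of X[j])`
(here the indices are shifted by one: `i` runs over `0, …, k-1` and `j` over `i, …, k-1`). -/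
def cusumStat (w : Placement L m → ℝ) (k : ℕ) (ω : Obs L) : ℝ≥0∞ :=
  ⨆ i ∈ Finset.range k, ∏ j ∈ Finset.Ico i k, mixtureRatio g f w (ω j)

/-- The M-CUSUM stopping time `inf {k ≥ 1 : W_w[k] ≥ e^b}` (`∞` if there is no such `k`). -/
def cusumTime (w : Placement L m → ℝ) (b : ℝ) (ω : Obs L) : ℕ∞ :=
  ⨅ (k : ℕ) (_ : 1 ≤ k ∧ ENNReal.ofReal (Real.exp b) ≤ cusumStat g f w k ω), (k : ℕ∞)

end Model

/-- The uniform weights on the placements of size `m` among `L` sensors. -/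
def uniformWeights (L m : ℕ) : Placement L m → ℝ := fun _ => 1 / (L.choose m : ℝ)

end

end MovingAnomaly

/-! Upper bound: a permutation of the sensors carries any placement to any other and fixes the
uniform mixture ratio, so this ratio has the same law ρ' under every p_E (`postRatioLaw_eq`). After
the change, Page's statistic is therefore a Markov chain that does not see the anomaly path. It
takes longest to reach `B` = e^b from the start 0, so the delay of the test is at most d =
`meanRunLength ρ' B 0` (`WADD_cusumTime_le`).

Lower bound: the worst path is at least as bad as an average over paths drawn uniformly and
independently in time, and this average replaces p_E by the mixture (`lintegral_mixture_le`). What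
remains is Moustakides' argument for Lorden's criterion. Weighting the changepoint ν by (1 - W_ν)^+
gives, under the no-change law, Σ E[max(W_k, 1); τ > k] ≤ WADD(τ) · Σ E[(1 - W_k)^+; τ > k]
(`sum_lintegral_max_le`). Let a(w) be the mean run length before the change and c the Lagrange
multiplier. The drift inequality `drift_le`, summed over time, gives d · Σ E[(1 - W_k)^+; τ > k] + c
· Σ P(τ > k) ≤ Σ E[max(W_k, 1); τ > k] + c · a(0). If the mean of τ is at least a(0), the two
inequalities force WADD(τ) ≥ d (`meanRunLength_le_WADD`). The delicate point is the drift above the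
threshold, `multiplier_mul_le`, which rests on the monotonicity in `weightedDelay_add_le`. -/

namespace MovingAnomaly

/-! ### Page's recursion as a one-dimensional killed Markov chain, and its Lagrangian stopping
problem. -/

section PageOperator

/-- One step of Page's recursion `w ↦ max w 1 * l`, killed when it reaches level `B`, with
likelihood ratio `l` of law `ρ`. -/
noncomputable def pageStep (ρ : Measure ℝ≥0∞) (B : ℝ≥0∞) (u : ℝ≥0∞ → ℝ≥0∞) (w : ℝ≥0∞) : ℝ≥0∞ :=
  ∫⁻ l, (Set.Iio B).indicator u (max w 1 * l) ∂ρ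

/-- The probability that Page's recursion started at `w` stays below `B` during `n` steps. -/
noncomputable def survival (ρ : Measure ℝ≥0∞) (B : ℝ≥0∞) : ℕ → ℝ≥0∞ → ℝ≥0∞
  | 0 => fun _ => 1
  | n + 1 => pageStep ρ B (survival ρ B n)

/-- The mean number of steps that Page's recursion started at `w` takes to reach `B`. -/
noncomputable def meanRunLength (ρ : Measure ℝ≥0∞) (B w : ℝ≥0∞) : ℝ≥0∞ :=
  ∑' n, survival ρ B n w

variable {ρ ρ' : Measure ℝ≥0∞} {B : ℝ≥0∞} {u v : ℝ≥0∞ → ℝ≥0∞} {w w' : ℝ≥0∞}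

lemma measurable_indicator_page (hu : Measurable u) (w : ℝ≥0∞) :
    Measurable fun l => (Set.Iio B).indicator u (max w 1 * l) :=
  (hu.indicator measurableSet_Iio).comp (by fun_prop)

lemma pageStep_congr (h : max w 1 = max w' 1) : pageStep ρ B u w = pageStep ρ B u w' := by
  simp only [pageStep, h]

lemma pageStep_mono (h : ∀ w < B, u w ≤ v w) (w : ℝ≥0∞) : pageStep ρ B u w ≤ pageStep ρ B v w := by
  refine lintegral_mono fun l => ?_
  by_cases hl : max w 1 * l < B
  · simpa [Set.indicator, hl] using h _ hl
  · simp [Set.indicator, hl]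

lemma pageStep_add (hu : Measurable u) (w : ℝ≥0∞) :
    pageStep ρ B (fun x => u x + v x) w = pageStep ρ B u w + pageStep ρ B v w := by
  rw [pageStep, pageStep, pageStep, ← lintegral_add_left (measurable_indicator_page hu w)]
  refine lintegral_congr fun l => ?_
  by_cases hl : max w 1 * l < B <;> simp [Set.indicator, hl]

lemma pageStep_const_mul (hu : Measurable u) (c w : ℝ≥0∞) :
    pageStep ρ B (fun x => c * u x) w = c * pageStep ρ B u w := by
  rw [pageStep, pageStep, ← lintegral_const_mul _ (measurable_indicator_page hu w)]
  refine lintegral_congr fun l => ?_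
  by_cases hl : max w 1 * l < B <;> simp [Set.indicator, hl]

lemma antitone_pageStep (hu : Antitone u) : Antitone (pageStep ρ B u) := by
  intro w w' h
  refine lintegral_mono fun l => ?_
  have hl : max w 1 * l ≤ max w' 1 * l := by gcongr
  by_cases h' : max w' 1 * l < B
  · simpa [Set.indicator, h', hl.trans_lt h'] using hu hl
  · simp [Set.indicator, h']

lemma antitone_survival (n : ℕ) : Antitone (survival ρ B n) := by
  induction n with
  | zero => exact antitone_const
  | succ n ih => exact antitone_pageStep ih

lemma measurable_survival (n : ℕ) : Measurable (survival ρ B n) := (antitone_survival n).measurable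

/-- A statistic below 1 is reset to 1 at the next step, so all starting points in [0, 1] are
equivalent. -/
lemma survival_congr (h : max w 1 = max w' 1) (n : ℕ) : survival ρ B n w = survival ρ B n w' := by
  cases n with
  | zero => rfl
  | succ n => exact pageStep_congr h

lemma antitone_meanRunLength : Antitone (meanRunLength ρ B) := fun _ _ h =>
  ENNReal.tsum_le_tsum fun n => antitone_survival n h

lemma measurable_meanRunLength : Measurable (meanRunLength ρ B) := antitone_meanRunLength.measurable

lemma meanRunLength_congr (h : max w 1 = max w' 1) :
    meanRunLength ρ B w = meanRunLength ρ B w' :=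
  tsum_congr fun n => survival_congr h n

lemma meanRunLength_eq (w : ℝ≥0∞) :
    meanRunLength ρ B w = 1 + pageStep ρ B (meanRunLength ρ B) w := by
  rw [meanRunLength, tsum_eq_zero_add' ENNReal.summable]
  congr 1
  simp only [survival, pageStep]
  rw [← lintegral_tsum fun n => (measurable_indicator_page (measurable_survival n) w).aemeasurable]
  refine lintegral_congr fun l => ?_
  by_cases hl : max w 1 * l < B <;> simp [Set.indicator, hl, meanRunLength]

lemma one_le_meanRunLength (w : ℝ≥0∞) : 1 ≤ meanRunLength ρ B w := by
  rw [meanRunLength_eq]; exact le_self_add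

/-- Change of measure in one step of Page's recursion. -/
lemma max_mul_pageStep (htilt : ρ'.restrict (Set.Iio ∞) = ρ.withDensity fun l => l)
    (hu : Measurable u) (w : ℝ≥0∞) :
    max w 1 * pageStep ρ' B u w = pageStep ρ B (fun v => v * u v) w := by
  have hind : pageStep ρ' B u w
      = ∫⁻ l in Set.Iio ∞, (Set.Iio B).indicator u (max w 1 * l) ∂ρ' := by
    rw [← lintegral_indicator measurableSet_Iio]
    refine lintegral_congr fun l => ?_
    by_cases hl : l < ∞
    · simp [hl]
    · obtain rfl : l = ∞ := by simpa using hl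
      simp [Set.indicator]
  rw [hind, htilt, lintegral_withDensity_eq_lintegral_mul _ measurable_id'
    (measurable_indicator_page hu w), ← lintegral_const_mul _ (by
      exact measurable_id'.mul (measurable_indicator_page hu w))]
  refine lintegral_congr fun l => ?_
  by_cases hl : max w 1 * l < B <;> simp [Set.indicator, hl, mul_assoc]

/-- The mean run length under the tilted law, weighted by the starting point. -/
noncomputable def weightedDelay (ρ' : Measure ℝ≥0∞) (B w : ℝ≥0∞) : ℝ≥0∞ :=
  w * meanRunLength ρ' B w

lemma measurable_weightedDelay : Measurable (weightedDelay ρ' B) :=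
  measurable_id'.mul measurable_meanRunLength

lemma max_mul_meanRunLength (htilt : ρ'.restrict (Set.Iio ∞) = ρ.withDensity fun l => l)
    (w : ℝ≥0∞) :
    max w 1 * meanRunLength ρ' B w = max w 1 + pageStep ρ B (weightedDelay ρ' B) w := by
  rw [meanRunLength_eq, mul_add, mul_one, max_mul_pageStep htilt measurable_meanRunLength]
  rfl

/-- While the chain is alive, the accumulated likelihood ratio times `max w 1` is at most the
statistic, hence at most `B`. Survival after the change is thus controlled by survival before it,
which yields finiteness of the delay. -/
lemma max_mul_survival_le (htilt : ρ'.restrict (Set.Iio ∞) = ρ.withDensity fun l => l)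
    (hB : 1 ≤ B) (n : ℕ) :
    ∀ w ≤ B, max w 1 * survival ρ' B n w ≤ B * survival ρ B n w := by
  induction n with
  | zero => intro w hw; simpa [survival] using ⟨hw, hB⟩
  | succ n ih =>
    intro w _
    simp only [survival]
    rw [max_mul_pageStep htilt (measurable_survival n), ← pageStep_const_mul (measurable_survival n)]
    exact pageStep_mono (fun v hv => (by gcongr; exact le_max_left _ _ : _ ≤ _).trans (ih v hv.le)) w

lemma meanRunLength_ne_top (htilt : ρ'.restrict (Set.Iio ∞) = ρ.withDensity fun l => l)
    (hB : 1 ≤ B) (hB' : B ≠ ∞) (ha : meanRunLength ρ B 0 ≠ ∞) : meanRunLength ρ' B 0 ≠ ∞ := by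
  have h : meanRunLength ρ' B 0 ≤ B * meanRunLength ρ B 0 := by
    rw [meanRunLength, meanRunLength, ← ENNReal.tsum_mul_left]
    exact ENNReal.tsum_le_tsum fun n => by
      simpa using max_mul_survival_le htilt hB n 0 zero_le
  exact ne_top_of_le_ne_top (ENNReal.mul_ne_top hB' ha) h

/-- The Lagrange multiplier for the constraint on the mean time to false alarm. -/
noncomputable def multiplier (ρ ρ' : Measure ℝ≥0∞) (B : ℝ≥0∞) : ℝ≥0∞ :=
  ⨆ w ∈ Set.Iio B, weightedDelay ρ' B w / meanRunLength ρ B w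

lemma weightedDelay_le (ha : meanRunLength ρ B 0 ≠ ∞) (hw : w < B) :
    weightedDelay ρ' B w ≤ multiplier ρ ρ' B * meanRunLength ρ B w := by
  have h : weightedDelay ρ' B w / meanRunLength ρ B w ≤ multiplier ρ ρ' B :=
    le_iSup₂ (f := fun w _ => weightedDelay ρ' B w / meanRunLength ρ B w) w hw
  rwa [ENNReal.div_le_iff_le_mul] at h
  · exact Or.inl (zero_lt_one.trans_le (one_le_meanRunLength w)).ne'
  · exact Or.inl (ne_top_of_le_ne_top ha (antitone_meanRunLength zero_le))

lemma multiplier_ne_top (htilt : ρ'.restrict (Set.Iio ∞) = ρ.withDensity fun l => l)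
    (hB : 1 ≤ B) (hB' : B ≠ ∞) (ha : meanRunLength ρ B 0 ≠ ∞) : multiplier ρ ρ' B ≠ ∞ := by
  refine ne_top_of_le_ne_top (ENNReal.mul_ne_top hB' (meanRunLength_ne_top htilt hB hB' ha))
    (iSup₂_le fun w hw => ENNReal.div_le_of_le_mul ?_)
  calc weightedDelay ρ' B w ≤ B * meanRunLength ρ' B 0 := by
        unfold weightedDelay
        gcongr
        · exact le_of_lt hw
        · exact antitone_meanRunLength zero_le
    _ = B * meanRunLength ρ' B 0 * 1 := (mul_one _).symm
    _ ≤ _ := by gcongr; exact one_le_meanRunLength w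

/-- Up to an error that vanishes as `n` grows, d - c·a is nondecreasing, where d is `weightedDelay`,
a is `meanRunLength ρ B` and c is the multiplier. The form is additive because subtraction in `ℝ≥0∞`
truncates. The proof couples the chains from `w` and `w'` through the same likelihood ratios; the
error is what is lost if the upper chain survives all `n` steps. -/
lemma weightedDelay_add_le_add_survival
    (htilt : ρ'.restrict (Set.Iio ∞) = ρ.withDensity fun l => l)
    (ha : meanRunLength ρ B 0 ≠ ∞) (n : ℕ) :
    ∀ w w', w ≤ w' → w < B →
      weightedDelay ρ' B w + multiplier ρ ρ' B * meanRunLength ρ B w'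
        ≤ weightedDelay ρ' B w' + multiplier ρ ρ' B * meanRunLength ρ B w
          + multiplier ρ ρ' B * meanRunLength ρ B 0 * survival ρ B n w' := by
  set c := multiplier ρ ρ' B with hc
  set a := meanRunLength ρ B with ha'
  set d := weightedDelay ρ' B with hd
  have hma : Measurable a := measurable_meanRunLength
  have hmd : Measurable d := measurable_weightedDelay
  induction n with
  | zero =>
    intro w w' _ hwB
    simp only [survival, mul_one]
    gcongr
    · exact (weightedDelay_le ha hwB).trans le_add_self
    · exact antitone_meanRunLength zero_le
  | succ n ih =>
    intro w w' hw hwB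
    have hms := measurable_survival (ρ := ρ) (B := B) n
    -- If `w' ≤ 1`, both chains restart from 1, so the run lengths agree and only the factors `w ≤
    -- w'` differ.
    rcases le_total w' 1 with h1 | h1
    · have hm : max w 1 = max w' 1 := by rw [max_eq_right h1, max_eq_right (hw.trans h1)]
      refine le_trans ?_ le_self_add
      rw [ha', meanRunLength_congr hm, hd, weightedDelay, weightedDelay, meanRunLength_congr hm]
      gcongr
    · have hdw : d w ≤ max w 1 + pageStep ρ B d w := by
        rw [hd, ← max_mul_meanRunLength htilt, weightedDelay]
        gcongr
        exact le_max_left _ _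
      have hdw' : d w' = w' + pageStep ρ B d w' := by
        have := max_mul_meanRunLength (B := B) htilt w'
        rwa [max_eq_left h1] at this
      have key : pageStep ρ B d w + c * pageStep ρ B a w'
          ≤ pageStep ρ B d w' + c * pageStep ρ B a w + c * a 0 * survival ρ B (n + 1) w' := by
        simp only [survival]
        rw [← pageStep_const_mul hma, ← pageStep_const_mul hma, ← pageStep_const_mul hms]
        simp only [pageStep]
        rw [← lintegral_add_left (measurable_indicator_page hmd _),
          ← lintegral_add_left (measurable_indicator_page hmd _),
          ← lintegral_add_right _ (measurable_indicator_page (hms.const_mul _) _)]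
        refine lintegral_mono fun l => ?_
        have hl : max w 1 * l ≤ max w' 1 * l := by gcongr
        -- The upper chain dies first. If both survive, induction applies; if only the lower one
        -- does, d ≤ c·a there by the choice of the multiplier; if neither does, both sides vanish.
        by_cases h2 : max w' 1 * l < B
        · simpa [Set.indicator, h2, hl.trans_lt h2] using ih _ _ hl (hl.trans_lt h2)
        · by_cases h3 : max w 1 * l < B
          · simpa [Set.indicator, h2, h3] using weightedDelay_le ha h3
          · simp [Set.indicator, h2, h3]
      calc d w + c * a w'
          ≤ (max w 1 + pageStep ρ B d w) + c * (1 + pageStep ρ B a w') := by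
            rw [ha', meanRunLength_eq w']; gcongr
        _ = max w 1 + c + (pageStep ρ B d w + c * pageStep ρ B a w') := by ring
        _ ≤ w' + c + (pageStep ρ B d w' + c * pageStep ρ B a w
              + c * a 0 * survival ρ B (n + 1) w') := by
            gcongr
            exact max_le hw h1
        _ = d w' + c * (1 + pageStep ρ B a w) + c * a 0 * survival ρ B (n + 1) w' := by
            rw [hdw']; ring
        _ = _ := by rw [ha', ← meanRunLength_eq w]

/-- The survival probabilities are summable because the mean run length is finite, so the error term
tends to 0. -/
lemma weightedDelay_add_le (htilt : ρ'.restrict (Set.Iio ∞) = ρ.withDensity fun l => l)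
    (hB : 1 ≤ B) (hB' : B ≠ ∞) (ha : meanRunLength ρ B 0 ≠ ∞) (hw : w ≤ w') (hwB : w < B) :
    weightedDelay ρ' B w + multiplier ρ ρ' B * meanRunLength ρ B w'
      ≤ weightedDelay ρ' B w' + multiplier ρ ρ' B * meanRunLength ρ B w := by
  have h0 := ENNReal.tendsto_atTop_zero_of_tsum_ne_top
    (ne_top_of_le_ne_top ha (antitone_meanRunLength (zero_le (a := w'))))
  have h1 := (ENNReal.Tendsto.const_mul h0 (Or.inr (ENNReal.mul_ne_top
    (multiplier_ne_top htilt hB hB' ha) ha))).const_add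
    (weightedDelay ρ' B w' + multiplier ρ ρ' B * meanRunLength ρ B w)
  rw [mul_zero, add_zero] at h1
  exact ge_of_tendsto' h1 fun n => weightedDelay_add_le_add_survival htilt ha n w w' hw hwB

/-- Just below the supremum defining the multiplier there is some w < `B` with d(w) - c·a(w) nearly
0, and monotonicity carries this sign to every point above `B`. -/
lemma multiplier_mul_le (htilt : ρ'.restrict (Set.Iio ∞) = ρ.withDensity fun l => l)
    (hB : 1 ≤ B) (hB' : B ≠ ∞) (ha : meanRunLength ρ B 0 ≠ ∞) (hw : B ≤ w') :
    multiplier ρ ρ' B * meanRunLength ρ B w' ≤ weightedDelay ρ' B w' := by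
  have hc := multiplier_ne_top htilt hB hB' ha
  rcases eq_or_ne (multiplier ρ ρ' B) 0 with h0 | h0
  · simp [h0]
  have ha0 : meanRunLength ρ B 0 ≠ 0 := (zero_lt_one.trans_le (one_le_meanRunLength 0)).ne'
  refine ENNReal.le_of_forall_pos_le_add fun ε hε _ => ?_
  -- Since a(w) ≤ a(0), lowering c by ε / a(0) costs at most ε in c·a(w).
  set q := multiplier ρ ρ' B - ε / meanRunLength ρ B 0 with hq
  have hε' : (ε : ℝ≥0∞) / meanRunLength ρ B 0 ≠ 0 :=
    (ENNReal.div_pos (by simpa using hε.ne') ha).ne'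
  have hqc : q < multiplier ρ ρ' B := ENNReal.sub_lt_self hc h0 hε'
  obtain ⟨w, hwB, hqw⟩ : ∃ w ∈ Set.Iio B, q < weightedDelay ρ' B w / meanRunLength ρ B w := by
    simpa only [lt_iSup_iff, exists_prop] using (show q < ⨆ w ∈ Set.Iio B, _ from hqc)
  have haw : meanRunLength ρ B w ≤ meanRunLength ρ B 0 := antitone_meanRunLength zero_le
  have haw' : meanRunLength ρ B w ≠ ∞ := ne_top_of_le_ne_top ha haw
  have hqw' : q * meanRunLength ρ B w ≤ weightedDelay ρ' B w :=
    ENNReal.mul_le_of_le_div hqw.le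
  have hsub : multiplier ρ ρ' B ≤ q + ε / meanRunLength ρ B 0 := le_tsub_add
  have h := weightedDelay_add_le htilt hB hB' ha ((le_of_lt hwB).trans hw) hwB
  refine (ENNReal.add_le_add_iff_left
    (ENNReal.mul_ne_top (ne_top_of_lt hqc) haw' : q * meanRunLength ρ B w ≠ ∞)).1 ?_
  calc q * meanRunLength ρ B w + multiplier ρ ρ' B * meanRunLength ρ B w'
      ≤ weightedDelay ρ' B w + multiplier ρ ρ' B * meanRunLength ρ B w' := by gcongr
    _ ≤ weightedDelay ρ' B w' + multiplier ρ ρ' B * meanRunLength ρ B w := h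
    _ ≤ weightedDelay ρ' B w' + (q + ε / meanRunLength ρ B 0) * meanRunLength ρ B w := by gcongr
    _ = q * meanRunLength ρ B w
        + (weightedDelay ρ' B w' + ε / meanRunLength ρ B 0 * meanRunLength ρ B w) := by ring
    _ ≤ q * meanRunLength ρ B w
        + (weightedDelay ρ' B w' + ε / meanRunLength ρ B 0 * meanRunLength ρ B 0) := by gcongr
    _ = q * meanRunLength ρ B w + (weightedDelay ρ' B w' + ε) := by
        rw [ENNReal.div_mul_cancel ha0 ha]

/-- The potential of the Lagrangian stopping problem. -/
noncomputable def potential (ρ ρ' : Measure ℝ≥0∞) (B w : ℝ≥0∞) : ℝ≥0∞ :=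
  (Set.Iio B).indicator
    (fun w => multiplier ρ ρ' B * meanRunLength ρ B w - weightedDelay ρ' B w) w

lemma measurable_potential : Measurable (potential ρ ρ' B) :=
  ((measurable_meanRunLength.const_mul _).sub measurable_weightedDelay).indicator measurableSet_Iio

lemma potential_zero_le : potential ρ ρ' B 0 ≤ multiplier ρ ρ' B * meanRunLength ρ B 0 := by
  unfold potential
  exact (Set.indicator_le_self _ _ _).trans tsub_le_self

/-- The drift of the potential, which makes stopping at level `B` optimal. -/
lemma drift_le (htilt : ρ'.restrict (Set.Iio ∞) = ρ.withDensity fun l => l)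
    (hB : 1 ≤ B) (hB' : B ≠ ∞) (ha : meanRunLength ρ B 0 ≠ ∞) (w : ℝ≥0∞) :
    meanRunLength ρ' B 0 * (1 - w) + multiplier ρ ρ' B
        + ∫⁻ l, potential ρ ρ' B (max w 1 * l) ∂ρ
      ≤ max w 1 + potential ρ ρ' B w := by
  set c := multiplier ρ ρ' B with hc
  set a := meanRunLength ρ B with ha'
  set d := weightedDelay ρ' B with hd
  have hma : Measurable a := measurable_meanRunLength
  have hmd : Measurable d := measurable_weightedDelay
  have hd0 := meanRunLength_ne_top htilt hB hB' ha
  have hint : ∫⁻ l, potential ρ ρ' B (max w 1 * l) ∂ρ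
      = pageStep ρ B (fun w => c * a w - d w) w := rfl
  have hsplit : pageStep ρ B (fun w => c * a w - d w) w + pageStep ρ B d w
      = c * pageStep ρ B a w := by
    rw [← pageStep_const_mul hma, ← pageStep_add (u := fun w => c * a w - d w) ((hma.const_mul c).sub hmd)]
    refine le_antisymm (pageStep_mono (fun v hv => ?_) w) (pageStep_mono (fun v hv => ?_) w)
    · exact (tsub_add_cancel_of_le (weightedDelay_le ha hv)).le
    · exact (tsub_add_cancel_of_le (weightedDelay_le ha hv)).ge
  have hstep : max w 1 * meanRunLength ρ' B w = max w 1 + pageStep ρ B d w :=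
    max_mul_meanRunLength htilt w
  have hdfin : pageStep ρ B d w ≠ ∞ := by
    -- From ∞ the next value is ∞, which is killed, or 0 (when `l = 0`), where `weightedDelay`
    -- vanishes.
    rcases eq_or_ne w ∞ with rfl | hw
    · refine ne_top_of_le_ne_top ENNReal.zero_ne_top ?_
      rw [pageStep, nonpos_iff_eq_zero, lintegral_eq_zero_iff (measurable_indicator_page hmd _)]
      refine ae_of_all _ fun l => ?_
      rcases eq_or_ne l 0 with rfl | hl
      · simp [Set.indicator, hd, weightedDelay]
      · simp [Set.indicator, ENNReal.top_mul hl]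
    · refine ne_top_of_le_ne_top (b := max w 1 * meanRunLength ρ' B w) (ENNReal.mul_ne_top
        (by simp [hw]) (ne_top_of_le_ne_top hd0 (antitone_meanRunLength zero_le))) ?_
      rw [hstep]; exact le_add_self
  rw [hint]
  rcases lt_or_ge w B with hw | hw
  · have hpot : potential ρ ρ' B w = c * a w - d w := by
      simp [potential, Set.indicator, hw, hc, ha', hd]
    have hle : d w ≤ c * a w := weightedDelay_le ha hw
    have hdw : d w ≠ ∞ := ENNReal.mul_ne_top (ne_top_of_lt hw)
      (ne_top_of_le_ne_top hd0 (antitone_meanRunLength zero_le))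
    -- For `w ≤ 1` the run length from `w` equals that from 0, so the weights 1 - w and w add up to
    -- one full delay.
    have hsum : meanRunLength ρ' B 0 * (1 - w) + d w = max w 1 + pageStep ρ B d w := by
      rw [← hstep]
      rcases le_total w 1 with h1 | h1
      · have hm : max w 1 = max 0 1 := by simp [h1]
        rw [hd, weightedDelay, meanRunLength_congr hm, mul_comm w, ← mul_add,
          tsub_add_cancel_of_le h1, max_eq_right h1, mul_comm]
      · rw [tsub_eq_zero_of_le h1, max_eq_left h1, mul_zero, zero_add, hd, weightedDelay]
    rw [hpot]
    -- Below the threshold the drift relation is an equality; adding the finite subtracted terms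
    -- removes the truncated differences.
    refine (ENNReal.add_le_add_iff_left (ENNReal.add_ne_top.2 ⟨hdw, hdfin⟩)).1 (le_of_eq ?_)
    calc d w + pageStep ρ B d w + (meanRunLength ρ' B 0 * (1 - w) + c
          + pageStep ρ B (fun w => c * a w - d w) w)
        = (meanRunLength ρ' B 0 * (1 - w) + d w) + c
          + (pageStep ρ B (fun w => c * a w - d w) w + pageStep ρ B d w) := by ring
      _ = max w 1 + pageStep ρ B d w + c * (1 + pageStep ρ B a w) := by rw [hsum, hsplit]; ring
      _ = max w 1 + pageStep ρ B d w + c * a w := by rw [ha', ← meanRunLength_eq w]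
      _ = max w 1 + pageStep ρ B d w + (c * a w - d w + d w) := by rw [tsub_add_cancel_of_le hle]
      _ = _ := by ring
  · have h1 : 1 ≤ w := hB.trans hw
    have hle : c * a w ≤ d w := multiplier_mul_le htilt hB hB' ha hw
    have hpot : potential ρ ρ' B w = 0 := by simp [potential, Set.indicator, hw.not_gt]
    rw [hpot, tsub_eq_zero_of_le h1, mul_zero, zero_add, add_zero, max_eq_left h1]
    refine (ENNReal.add_le_add_iff_right hdfin).1 ?_
    calc c + pageStep ρ B (fun w => c * a w - d w) w + pageStep ρ B d w
        = c * (1 + pageStep ρ B a w) := by rw [add_assoc, hsplit]; ring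
      _ = c * a w := by rw [ha', ← meanRunLength_eq w]
      _ ≤ d w := hle
      _ = w + pageStep ρ B d w := by rw [max_eq_left h1] at hstep; exact hstep

end PageOperator

/-! ### Infinite product laws: integrating out one coordinate, and domination of laws. -/

section ProductLaw

variable {X : Type*} [MeasurableSpace X] {μ μ' : ℕ → Measure X}
  [∀ n, IsProbabilityMeasure (μ n)] [∀ n, IsProbabilityMeasure (μ' n)]

lemma measurable_update_prod (n : ℕ) :
    Measurable fun p : (ℕ → X) × X => Function.update p.1 n p.2 := by
  refine measurable_pi_lambda _ fun i => ?_
  rcases eq_or_ne i n with rfl | h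
  · simpa using measurable_snd
  · simp only [Function.update_of_ne h]
    exact (measurable_pi_apply i).comp measurable_fst

/-- Resampling one coordinate leaves a product law invariant. -/
lemma map_update_infinitePi (n : ℕ) :
    ((Measure.infinitePi μ).prod (μ n)).map (fun p => Function.update p.1 n p.2)
      = Measure.infinitePi μ := by
  refine Measure.eq_infinitePi μ fun s t ht => ?_
  rw [Measure.map_apply (measurable_update_prod n)
    (MeasurableSet.pi s.countable_toSet fun i _ => ht i)]
  have hset : (fun p : (ℕ → X) × X => Function.update p.1 n p.2) ⁻¹' (s : Set ℕ).pi t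
      = (((s.erase n : Finset ℕ) : Set ℕ).pi t) ×ˢ (if n ∈ s then t n else Set.univ) := by
    ext ⟨ω, x⟩
    simp only [Set.mem_preimage, Set.mem_pi, Set.mem_prod, Finset.mem_coe, Finset.mem_erase]
    constructor
    · refine fun h => ⟨fun i hi => by simpa [Function.update_of_ne hi.1] using h i hi.2, ?_⟩
      split_ifs with hn
      · simpa using h n hn
      · trivial
    · rintro ⟨h1, h2⟩ i hi
      rcases eq_or_ne i n with rfl | hin
      · simpa [hi] using h2
      · simpa [Function.update_of_ne hin] using h1 i ⟨hin, hi⟩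
  rw [hset, Measure.prod_prod, Measure.infinitePi_pi _ fun i _ => ht i]
  split_ifs with hn
  · rw [mul_comm, Finset.mul_prod_erase s (fun i => μ i (t i)) hn]
  · rw [Finset.erase_eq_of_notMem hn, measure_univ, mul_one]

lemma lintegral_infinitePi_update (n : ℕ) {ψ : (ℕ → X) → ℝ≥0∞} (hψ : Measurable ψ) :
    ∫⁻ ω, ψ ω ∂Measure.infinitePi μ
      = ∫⁻ ω, ∫⁻ x, ψ (Function.update ω n x) ∂μ n ∂Measure.infinitePi μ := by
  conv_lhs => rw [← map_update_infinitePi (μ := μ) n]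
  rw [lintegral_map hψ (measurable_update_prod n),
    lintegral_prod (fun p : (ℕ → X) × X => ψ (Function.update p.1 n p.2))
      (hψ.comp (measurable_update_prod n)).aemeasurable]

lemma measurable_lintegral_update (ν : Measure X) [SFinite ν] (n : ℕ) {ψ : (ℕ → X) → ℝ≥0∞}
    (hψ : Measurable ψ) : Measurable fun ω => ∫⁻ x, ψ (Function.update ω n x) ∂ν :=
  Measurable.lintegral_prod_right' (hψ.comp (measurable_update_prod n))

lemma dependsOn_update {α Y : Type*} {φ : (ℕ → Y) → α} {k n : ℕ} (hφ : DependsOn φ (Set.Iio k))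
    (hkn : k ≤ n) (ω : ℕ → Y) (x : Y) : φ (Function.update ω n x) = φ ω :=
  hφ fun _ hi => Function.update_of_ne ((Set.mem_Iio.1 hi).trans_le hkn).ne _ _

/-- A coordinatewise domination of densities gives a domination of laws on the first `n`
coordinates. -/
lemma lintegral_mul_prod_le {r : ℕ → X → ℝ≥0∞} (hr : ∀ j, Measurable (r j))
    (h : ∀ j, (μ j).withDensity (r j) ≤ μ' j) (n : ℕ) :
    ∀ ψ : (ℕ → X) → ℝ≥0∞, Measurable ψ → DependsOn ψ (Set.Iio n) →
      ∫⁻ ω, ψ ω * ∏ j ∈ Finset.range n, r j (ω j) ∂Measure.infinitePi μ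
        ≤ ∫⁻ ω, ψ ω ∂Measure.infinitePi μ' := by
  have hprod : ∀ n, Measurable fun ω : ℕ → X => ∏ j ∈ Finset.range n, r j (ω j) := fun n =>
    Finset.measurable_prod _ fun j _ => (hr j).comp (measurable_pi_apply j)
  induction n with
  | zero =>
    intro ψ _ hd
    rcases isEmpty_or_nonempty (ℕ → X) with hX | ⟨⟨ω₀⟩⟩
    · simp [lintegral_of_isEmpty]
    have hc : ∀ ω, ψ ω = ψ ω₀ := fun ω => hd (by simp)
    simp [hc]
  | succ n ih =>
    intro ψ hψ hd
    rw [lintegral_infinitePi_update (ψ := fun ω => ψ ω * ∏ j ∈ Finset.range (n + 1), r j (ω j)) n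
        (hψ.mul (hprod (n + 1))),
      lintegral_infinitePi_update (μ := μ') n hψ]
    refine le_trans (lintegral_mono fun ω => ?_) (ih _ (measurable_lintegral_update _ n hψ) ?_)
    · have hup : Measurable fun x => ψ (Function.update ω n x) :=
        hψ.comp ((measurable_update_prod n).comp measurable_prodMk_left)
      calc ∫⁻ x, ψ (Function.update ω n x)
              * ∏ j ∈ Finset.range (n + 1), r j (Function.update ω n x j) ∂μ n
          = ∫⁻ x, (∏ j ∈ Finset.range n, r j (ω j)) * (r n x * ψ (Function.update ω n x)) ∂μ n := by
            refine lintegral_congr fun x => ?_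
            rw [Finset.prod_range_succ, Function.update_self, Finset.prod_congr rfl fun j hj => by
              rw [Function.update_of_ne (Finset.mem_range.1 hj).ne]]
            ring
        _ = (∏ j ∈ Finset.range n, r j (ω j))
              * ∫⁻ x, ψ (Function.update ω n x) ∂(μ n).withDensity (r n) := by
            rw [lintegral_withDensity_eq_lintegral_mul _ (hr n) hup,
              ← lintegral_const_mul _ ((hr n).mul hup)]
            rfl
        _ ≤ (∏ j ∈ Finset.range n, r j (ω j)) * ∫⁻ x, ψ (Function.update ω n x) ∂μ' n := by
            gcongr
            exact h n
        _ = _ := mul_comm _ _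
    · intro ω ω' hω
      refine lintegral_congr fun x => hd fun i hi => ?_
      rcases eq_or_ne i n with rfl | hin
      · simp
      · simpa [Function.update_of_ne hin] using hω i (by
          simp only [Set.mem_Iio] at hi ⊢; omega)

end ProductLaw

/-! ### Measurability with respect to the past as dependence on finitely many coordinates. -/

section ObservationFiltration

variable {L : ℕ}

lemma obsFiltration_le_comap (k : ℕ) :
    (obsFiltration L k : MeasurableSpace (Obs L))
      ≤ MeasurableSpace.comap (Set.Iio k).domRestrict inferInstance := by
  refine iSup₂_le fun n hn => ?_
  rintro _ ⟨s, hs, rfl⟩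
  exact ⟨(fun y => y ⟨n, hn⟩) ⁻¹' s, measurable_pi_apply _ hs, rfl⟩

lemma dependsOn_of_measurable {φ : Obs L → ℝ≥0∞} {k : ℕ}
    (hφ : Measurable[obsFiltration L k] φ) : DependsOn φ (Set.Iio k) := by
  intro ω ω' h
  obtain ⟨t, -, ht⟩ := obsFiltration_le_comap k _ (hφ (measurableSet_singleton (φ ω)))
  have h1 : ω ∈ φ ⁻¹' {φ ω} := rfl
  have h2 : ω' ∈ φ ⁻¹' {φ ω} := by
    rw [← ht] at h1 ⊢
    have he : (Set.Iio k).domRestrict ω' = (Set.Iio k).domRestrict ω :=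
      funext fun i => (h i i.2).symm
    rwa [Set.mem_preimage, he]
  exact h2.symm

lemma measurable_eval_obsFiltration {n k : ℕ} (hn : n < k) :
    Measurable[obsFiltration L k] fun ω : Obs L => ω n := by
  refine Measurable.mono (comap_measurable _) ?_ le_rfl
  exact le_iSup₂ (f := fun n (_ : n < k) => MeasurableSpace.comap (fun ω : Obs L => ω n) _) n hn

end ObservationFiltration

/-! ### Conditional expectations tested against weights and events. -/

section ConditionalExpectation

variable {Ω : Type*} {m m₀ : MeasurableSpace Ω} {P : Measure Ω} [IsFiniteMeasure P]

lemma lintegral_mul_condLExp (hm : m ≤ m₀) {φ Y : Ω → ℝ≥0∞} (hφ : Measurable[m] φ)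
    (hY : Measurable Y) : ∫⁻ ω, φ ω * P⁻[Y|m] ω ∂P = ∫⁻ ω, φ ω * Y ω ∂P := by
  have htrim : (P.withDensity (P⁻[Y|m])).trim hm = (P.withDensity Y).trim hm := by
    refine @Measure.ext _ m _ _ fun s hs => ?_
    rw [trim_measurableSet_eq hm hs, trim_measurableSet_eq hm hs, withDensity_apply _ (hm s hs),
      withDensity_apply _ (hm s hs), setLIntegral_condLExp hm P Y hs]
  have h := congrArg (fun κ => ∫⁻ ω, φ ω ∂κ) htrim
  simp only [lintegral_trim hm hφ] at h
  rw [lintegral_withDensity_eq_lintegral_mul _ (measurable_condLExp' m P Y) (hφ.mono hm le_rfl),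
    lintegral_withDensity_eq_lintegral_mul _ hY (hφ.mono hm le_rfl)] at h
  simpa only [Pi.mul_apply, mul_comm] using h

lemma ae_restrict_condLExp_le (hm : m ≤ m₀) {Y : Ω → ℝ≥0∞} {A : Set Ω} (hA : MeasurableSet[m] A)
    {c : ℝ≥0∞} (h : ∀ s, MeasurableSet[m] s → ∫⁻ ω in s ∩ A, Y ω ∂P ≤ c * P (s ∩ A)) :
    ∀ᵐ ω ∂P.restrict A, P⁻[Y|m] ω ≤ c := by
  rw [ae_restrict_iff' (hm A hA)]
  have hY := measurable_condLExp m P Y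
  have key : A.indicator (P⁻[Y|m]) ≤ᵐ[P.trim hm] fun _ => c := by
    refine ae_le_of_forall_setLIntegral_le_of_sigmaFinite (hY.indicator hA) fun s hs _ => ?_
    rw [setLIntegral_indicator hA, setLIntegral_trim hm hY (hA.inter hs),
      setLIntegral_condLExp hm P Y (hA.inter hs), setLIntegral_const, Set.inter_comm]
    refine (h s hs).trans ?_
    rw [trim_measurableSet_eq hm hs]
    gcongr
    exact Set.inter_subset_left
  filter_upwards [ae_of_ae_trim hm key] with ω hω hωA
  simpa [hωA] using hω

end ConditionalExpectation

/-! ### Stopping times and their delays as sums of indicators. -/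

section StoppingTime

variable {L : ℕ} {τ : Obs L → ℕ∞}

/-- The indicator function of the event `{τ > k}`. -/
noncomputable def alive (τ : Obs L → ℕ∞) (k : ℕ) : Obs L → ℝ≥0∞ :=
  Set.indicator {ω | (k : ℕ∞) < τ ω} 1

lemma measurableSet_lt_of_isStoppingTime (hτ : IsStoppingTime (obsFiltration L) τ) (k : ℕ) :
    MeasurableSet[obsFiltration L k] {ω | (k : ℕ∞) < τ ω} := by
  have h : {ω | (k : ℕ∞) < τ ω} = {ω | τ ω ≤ (k : ℕ∞)}ᶜ := by ext; simp
  rw [h]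
  exact (hτ k).compl

lemma measurable_alive (hτ : IsStoppingTime (obsFiltration L) τ) (k : ℕ) :
    Measurable[obsFiltration L k] (alive τ k) :=
  Measurable.indicator measurable_const (measurableSet_lt_of_isStoppingTime hτ k)

lemma alive_anti {j k : ℕ} (h : j ≤ k) (ω : Obs L) : alive τ k ω ≤ alive τ j ω := by
  by_cases hk : (k : ℕ∞) < τ ω
  · have hj : (j : ℕ∞) < τ ω := lt_of_le_of_lt (by exact_mod_cast h) hk
    simp [alive, hk, hj]
  · simp [alive, hk]

lemma alive_mul_alive {j k : ℕ} (h : j ≤ k) (ω : Obs L) :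
    alive τ j ω * alive τ k ω = alive τ k ω := by
  by_cases hk : (k : ℕ∞) < τ ω
  · have hj : (j : ℕ∞) < τ ω := lt_of_le_of_lt (by exact_mod_cast h) hk
    simp [alive, hk, hj]
  · simp [alive, hk]

lemma alive_zero (hτ : ∀ ω, 1 ≤ τ ω) (ω : Obs L) : alive τ 0 ω = 1 := by
  have h : (0 : ℕ∞) < τ ω := lt_of_lt_of_le one_pos (hτ ω)
  simp [alive, h]

lemma alive_le_one (k : ℕ) (ω : Obs L) : alive τ k ω ≤ 1 := by
  unfold alive
  exact Set.indicator_le_self _ (1 : Obs L → ℝ≥0∞) _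

lemma toENNReal_sub_eq_tsum (t : ℕ∞) (ν : ℕ) :
    (t : ℝ≥0∞) - (ν : ℝ≥0∞) = ∑' n : ℕ, if ((ν + n : ℕ) : ℕ∞) < t then 1 else 0 := by
  induction t with
  | top => simp
  | coe t =>
    rw [tsum_eq_sum (s := Finset.range (t - ν)) fun n hn => by
        rw [Finset.mem_range] at hn
        rw [if_neg]
        norm_cast
        omega,
      Finset.sum_congr rfl fun n hn => if_pos (by
        rw [Finset.mem_range] at hn
        norm_cast
        omega)]
    simp

lemma delay_eq_tsum (τ : Obs L → ℕ∞) (ν : ℕ) (ω : Obs L) :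
    (τ ω : ℝ≥0∞) - (ν : ℝ≥0∞) = ∑' n, alive τ (ν + n) ω := by
  rw [toENNReal_sub_eq_tsum]
  refine tsum_congr fun n => ?_
  simp [alive, Set.indicator]

lemma measurable_alive_pi (hτ : IsStoppingTime (obsFiltration L) τ) (k : ℕ) :
    Measurable (alive τ k) :=
  (measurable_alive hτ k).mono ((obsFiltration L).le k) le_rfl

lemma measurable_delay (hτ : IsStoppingTime (obsFiltration L) τ) (ν : ℕ) :
    Measurable fun ω => (τ ω : ℝ≥0∞) - (ν : ℝ≥0∞) := by
  simp only [delay_eq_tsum]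
  exact Measurable.tsum fun n => measurable_alive_pi hτ _

end StoppingTime

/-! ### The essential supremum of the conditional delay as an integral inequality. -/

section Delay

variable {L m : ℕ} {g f : Fin L → ℝ → ℝ} {τ : Obs L → ℕ∞} {ν : ℕ} {S : ℕ → Placement L m}
  [IsFiniteMeasure (changeLaw g f ν S)] {c : ℝ≥0∞}

/-- Together with `lintegral_delay_le`, this trades the essential supremum for an inequality tested
against weights from the past. The hypothesis `1 ≤ c` covers the convention for a null event {τ >
ν}. -/
lemma condDelay_le (hτ : IsStoppingTime (obsFiltration L) τ) (hc : 1 ≤ c)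
    (h : ∀ φ : Obs L → ℝ≥0∞, Measurable[obsFiltration L ν] φ →
      ∫⁻ ω, φ ω * alive τ ν ω * ((τ ω : ℝ≥0∞) - (ν : ℝ≥0∞)) ∂changeLaw g f ν S
        ≤ c * ∫⁻ ω, φ ω * alive τ ν ω ∂changeLaw g f ν S) :
    condDelay g f τ ν S ≤ c := by
  unfold condDelay
  split_ifs with h0
  · exact hc
  have hA := measurableSet_lt_of_isStoppingTime hτ ν
  have hle := (obsFiltration L).le ν
  refine essSup_le_of_ae_le _ (ae_restrict_condLExp_le hle hA fun s hs => ?_)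
  have hsA : MeasurableSet (s ∩ {ω | (ν : ℕ∞) < τ ω}) := hle _ (hs.inter hA)
  have hind : ∀ ω, s.indicator (1 : Obs L → ℝ≥0∞) ω * alive τ ν ω
      = (s ∩ {ω | (ν : ℕ∞) < τ ω}).indicator (1 : Obs L → ℝ≥0∞) ω := fun ω => by
    rw [Set.inter_indicator_one]; rfl
  have h1 := h (s.indicator (1 : Obs L → ℝ≥0∞)) (Measurable.indicator measurable_const hs)
  simp only [hind] at h1
  rw [lintegral_indicator_one hsA] at h1
  rw [← lintegral_indicator hsA]
  refine le_trans (le_of_eq (lintegral_congr fun ω => ?_)) h1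
  by_cases hω : ω ∈ s ∩ {ω | (ν : ℕ∞) < τ ω} <;> simp only [Set.indicator, hω] <;> simp

lemma lintegral_delay_le (hτ : IsStoppingTime (obsFiltration L) τ)
    (hc : condDelay g f τ ν S ≤ c) {φ : Obs L → ℝ≥0∞} (hφ : Measurable[obsFiltration L ν] φ) :
    ∫⁻ ω, φ ω * alive τ ν ω * ((τ ω : ℝ≥0∞) - (ν : ℝ≥0∞)) ∂changeLaw g f ν S
      ≤ c * ∫⁻ ω, φ ω * alive τ ν ω ∂changeLaw g f ν S := by
  have hA := measurableSet_lt_of_isStoppingTime hτ ν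
  have hle := (obsFiltration L).le ν
  have hφa : Measurable[obsFiltration L ν] fun ω => φ ω * alive τ ν ω :=
    hφ.mul (measurable_alive hτ ν)
  unfold condDelay at hc
  split_ifs at hc with h0
  · have hz : ∀ᵐ ω ∂changeLaw g f ν S, alive τ ν ω = 0 := by
      filter_upwards [measure_eq_zero_iff_ae_notMem.1 h0] with ω hω
      simpa [alive] using hω
    have : ∫⁻ ω, φ ω * alive τ ν ω * ((τ ω : ℝ≥0∞) - (ν : ℝ≥0∞)) ∂changeLaw g f ν S = 0 := by
      rw [lintegral_congr_ae (g := fun _ => 0)]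
      · simp
      · filter_upwards [hz] with ω hω
        simp [hω]
    rw [this]
    exact zero_le
  · rw [← lintegral_mul_condLExp hle hφa (measurable_delay hτ ν),
      ← lintegral_const_mul _ (hφa.mono hle le_rfl)]
    have hae := ae_le_essSup (μ := (changeLaw g f ν S).restrict {ω | (ν : ℕ∞) < τ ω})
      (f := (changeLaw g f ν S)⁻[fun ω => (τ ω : ℝ≥0∞) - (ν : ℝ≥0∞) | obsFiltration L ν])
    rw [ae_restrict_iff' (hle _ hA)] at hae
    refine lintegral_mono_ae ?_
    filter_upwards [hae] with ω hω
    by_cases hωA : (ν : ℕ∞) < τ ω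
    · rw [mul_comm]
      gcongr
      exact (hω hωA).trans hc
    · simp [alive, hωA]

end Delay

/-! ### The CUSUM statistic: recursion, stopping time and Markov property. -/

section Cusum

variable {L m : ℕ} {g f : Fin L → ℝ → ℝ} {w : Placement L m → ℝ}

lemma measurable_preDensity (hg : ∀ ℓ, Measurable (g ℓ)) : Measurable (preDensity g) :=
  Finset.measurable_prod _ fun ℓ _ => ((hg ℓ).comp (measurable_pi_apply ℓ)).ennreal_ofReal

lemma measurable_postDensity (hg : ∀ ℓ, Measurable (g ℓ)) (hf : ∀ ℓ, Measurable (f ℓ))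
    (E : Placement L m) : Measurable (postDensity g f E) :=
  (Finset.measurable_prod _ fun ℓ _ => ((hf ℓ).comp (measurable_pi_apply ℓ)).ennreal_ofReal).mul
    (Finset.measurable_prod _ fun ℓ _ => ((hg ℓ).comp (measurable_pi_apply ℓ)).ennreal_ofReal)

lemma measurable_mixtureRatio (hg : ∀ ℓ, Measurable (g ℓ)) (hf : ∀ ℓ, Measurable (f ℓ)) :
    Measurable (mixtureRatio g f w) :=
  (Finset.measurable_sum _ fun E _ => (measurable_postDensity hg hf E).const_mul _).div
    (measurable_preDensity hg)

lemma cusumStat_zero (ω : Obs L) : cusumStat g f w 0 ω = 0 := by simp [cusumStat]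

/-- Page's recursion for the CUSUM statistic. -/
lemma cusumStat_succ (k : ℕ) (ω : Obs L) :
    cusumStat g f w (k + 1) ω = max (cusumStat g f w k ω) 1 * mixtureRatio g f w (ω k) := by
  have h1 : cusumStat g f w k ω * mixtureRatio g f w (ω k)
      = ⨆ i ∈ Finset.range k, ∏ j ∈ Finset.Ico i (k + 1), mixtureRatio g f w (ω j) := by
    simp only [cusumStat, ENNReal.iSup_mul]
    refine iSup_congr fun i => iSup_congr fun hi => ?_
    rw [Finset.prod_Ico_succ_top (Finset.mem_range.1 hi).le]
  rw [max_mul_of_nonneg _ _ zero_le, h1, one_mul, cusumStat, Finset.range_add_one,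
    Finset.iSup_insert, max_comm]
  simp

lemma measurable_cusumStat (hg : ∀ ℓ, Measurable (g ℓ)) (hf : ∀ ℓ, Measurable (f ℓ)) (k : ℕ) :
    Measurable[obsFiltration L k] (cusumStat g f w k) := by
  induction k with
  | zero =>
    have h : cusumStat g f w 0 = fun _ => 0 := funext cusumStat_zero
    rw [h]
    exact measurable_const
  | succ k ih =>
    have h : cusumStat g f w (k + 1)
        = fun ω => max (cusumStat g f w k ω) 1 * mixtureRatio g f w (ω k) :=
      funext (cusumStat_succ k)
    rw [h]
    exact ((ih.mono ((obsFiltration L).mono k.le_succ) le_rfl).max measurable_const).mul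
      ((measurable_mixtureRatio hg hf).comp (measurable_eval_obsFiltration k.lt_succ_self))

lemma measurable_cusumStat_pi (hg : ∀ ℓ, Measurable (g ℓ)) (hf : ∀ ℓ, Measurable (f ℓ)) (k : ℕ) :
    Measurable (cusumStat g f w k) :=
  (measurable_cusumStat hg hf k).mono ((obsFiltration L).le k) le_rfl

lemma lt_cusumTime_iff {b : ℝ} {k : ℕ} {ω : Obs L} :
    (k : ℕ∞) < cusumTime g f w b ω
      ↔ ∀ j, 1 ≤ j → j ≤ k → cusumStat g f w j ω < ENNReal.ofReal (Real.exp b) := by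
  rw [← ENat.add_one_le_iff (ENat.natCast_ne_top k), cusumTime]
  simp only [le_iInf_iff]
  constructor
  · intro h j hj hjk
    by_contra hlt
    have := h j ⟨hj, not_lt.1 hlt⟩
    norm_cast at this
    omega
  · rintro h j ⟨hj, hle⟩
    by_contra hlt
    norm_cast at hlt
    exact absurd (h j hj (by omega)) hle.not_gt

lemma lt_cusumTime_succ_iff {b : ℝ} {k : ℕ} {ω : Obs L} :
    ((k + 1 : ℕ) : ℕ∞) < cusumTime g f w b ω
      ↔ (k : ℕ∞) < cusumTime g f w b ω
        ∧ cusumStat g f w (k + 1) ω < ENNReal.ofReal (Real.exp b) := by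
  simp only [lt_cusumTime_iff]
  constructor
  · exact fun h => ⟨fun j h1 h2 => h j h1 (by omega), h _ (by omega) le_rfl⟩
  · rintro ⟨h, h'⟩ j h1 h2
    rcases Nat.lt_or_ge j (k + 1) with hj | hj
    · exact h j h1 (by omega)
    · obtain rfl : j = k + 1 := by omega
      exact h'

lemma one_le_cusumTime (b : ℝ) (ω : Obs L) : 1 ≤ cusumTime g f w b ω := by
  have h : ((0 : ℕ) : ℕ∞) < cusumTime g f w b ω := lt_cusumTime_iff.2 fun j h1 h2 => by omega
  exact Order.one_le_iff_pos.2 h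

lemma isStoppingTime_cusumTime (hg : ∀ ℓ, Measurable (g ℓ)) (hf : ∀ ℓ, Measurable (f ℓ)) (b : ℝ) :
    IsStoppingTime (obsFiltration L) (cusumTime g f w b) := by
  intro k
  have h : {ω | cusumTime g f w b ω ≤ (k : ℕ∞)}ᶜ
      = ⋂ j ∈ Set.Icc 1 k, {ω | cusumStat g f w j ω < ENNReal.ofReal (Real.exp b)} := by
    ext ω
    simp [lt_cusumTime_iff]
  refine MeasurableSet.of_compl ?_
  refine (congrArg (MeasurableSet[obsFiltration L k]) h).mpr ?_
  refine MeasurableSet.biInter (Set.to_countable _) fun j hj => ?_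
  exact measurableSet_lt
    ((measurable_cusumStat hg hf j).mono ((obsFiltration L).mono hj.2) le_rfl) measurable_const

/-- The decomposition of Page's statistic over the possible changepoints. -/
lemma max_cusumStat_eq_sum (k : ℕ) (ω : Obs L) :
    max (cusumStat g f w k ω) 1 = ∑ ν ∈ Finset.range (k + 1),
      (1 - cusumStat g f w ν ω) * ∏ j ∈ Finset.Ico ν k, mixtureRatio g f w (ω j) := by
  have hmax : ∀ x : ℝ≥0∞, max x 1 = x + (1 - x) := fun x => by
    rcases le_total x 1 with h | h
    · rw [max_eq_right h, add_tsub_cancel_of_le h]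
    · rw [max_eq_left h, tsub_eq_zero_of_le h, add_zero]
  induction k with
  | zero => simp [cusumStat_zero]
  | succ k ih =>
    have hs : cusumStat g f w (k + 1) ω = ∑ ν ∈ Finset.range (k + 1),
        (1 - cusumStat g f w ν ω) * ∏ j ∈ Finset.Ico ν (k + 1), mixtureRatio g f w (ω j) := by
      rw [cusumStat_succ, ih, Finset.sum_mul]
      refine Finset.sum_congr rfl fun ν hν => ?_
      rw [Finset.prod_Ico_succ_top (by rw [Finset.mem_range] at hν; omega), mul_assoc]
    rw [Finset.sum_range_succ, ← hs, hmax, Finset.Ico_self, Finset.prod_empty, mul_one]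

variable {μ : ℕ → Measure (Fin L → ℝ)} [∀ n, IsProbabilityMeasure (μ n)]

/-- The Markov property of Page's statistic. -/
lemma lintegral_mul_cusumStat_succ (hg : ∀ ℓ, Measurable (g ℓ)) (hf : ∀ ℓ, Measurable (f ℓ))
    {k : ℕ} {φ : Obs L → ℝ≥0∞} (hφ : Measurable[obsFiltration L k] φ) {u : ℝ≥0∞ → ℝ≥0∞}
    (hu : Measurable u) :
    ∫⁻ ω, φ ω * u (cusumStat g f w (k + 1) ω) ∂Measure.infinitePi μ
      = ∫⁻ ω, φ ω * ∫⁻ l, u (max (cusumStat g f w k ω) 1 * l)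
          ∂(μ k).map (mixtureRatio g f w) ∂Measure.infinitePi μ := by
  have hR := measurable_mixtureRatio (w := w) hg hf
  have hm : Measurable fun ω => φ ω * u (cusumStat g f w (k + 1) ω) :=
    (hφ.mono ((obsFiltration L).le k) le_rfl).mul (hu.comp (measurable_cusumStat_pi hg hf _))
  rw [lintegral_infinitePi_update k hm]
  refine lintegral_congr fun ω => ?_
  have hul : Measurable fun l => u (max (cusumStat g f w k ω) 1 * l) := by
    exact hu.comp (measurable_id'.const_mul _)
  rw [lintegral_map hul hR, ← lintegral_const_mul _ (show Measurable fun x =>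
    u (max (cusumStat g f w k ω) 1 * mixtureRatio g f w x) from hul.comp hR)]
  refine lintegral_congr fun x => ?_
  rw [cusumStat_succ, dependsOn_update (dependsOn_of_measurable hφ) le_rfl,
    dependsOn_update (dependsOn_of_measurable (measurable_cusumStat hg hf k)) le_rfl,
    Function.update_self]

/-- The Markov property is iterated. The observations need not be identically distributed: from ν
on, only the law of their ratio must be constant, which is what lets an arbitrary anomaly path
through. -/
lemma lintegral_mul_alive_cusumTime (hg : ∀ ℓ, Measurable (g ℓ)) (hf : ∀ ℓ, Measurable (f ℓ))
    {b : ℝ} {ρ : Measure ℝ≥0∞} (n : ℕ) :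
    ∀ ν : ℕ, (∀ j, ν ≤ j → (μ j).map (mixtureRatio g f w) = ρ) →
      ∀ φ : Obs L → ℝ≥0∞, Measurable[obsFiltration L ν] φ →
      ∫⁻ ω, φ ω * alive (cusumTime g f w b) (ν + n) ω ∂Measure.infinitePi μ
        = ∫⁻ ω, φ ω * alive (cusumTime g f w b) ν ω
            * survival ρ (ENNReal.ofReal (Real.exp b)) n (cusumStat g f w ν ω)
            ∂Measure.infinitePi μ := by
  have hst := isStoppingTime_cusumTime (w := w) hg hf b
  induction n with
  | zero => intro ν _ φ _; simp [survival]
  | succ n ih =>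
    intro ν hρ φ hφ
    have hφa : Measurable[obsFiltration L ν] fun ω => φ ω * alive (cusumTime g f w b) ν ω :=
      hφ.mul (measurable_alive hst ν)
    rw [show ν + (n + 1) = (ν + 1) + n by ring, ih (ν + 1) (fun j hj => hρ j (by omega)) φ
      (hφ.mono ((obsFiltration L).mono ν.le_succ) le_rfl)]
    simp only [survival, pageStep]
    rw [← hρ ν le_rfl, ← lintegral_mul_cusumStat_succ hg hf hφa
      ((measurable_survival n).indicator measurableSet_Iio)]
    refine lintegral_congr fun ω => ?_
    by_cases h1 : (ν : ℕ∞) < cusumTime g f w b ω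
    · by_cases h2 : cusumStat g f w (ν + 1) ω < ENNReal.ofReal (Real.exp b)
      · have h3 := lt_cusumTime_succ_iff.2 ⟨h1, h2⟩
        rw [Nat.cast_succ] at h3
        simp [alive, h1, h2, h3]
      · have h3 := not_lt.1 fun h => h2 (lt_cusumTime_succ_iff.1 h).2
        rw [Nat.cast_succ] at h3
        simp [alive, h2, h3]
    · have h3 := not_lt.1 fun h => h1 (lt_cusumTime_succ_iff.1 h).1
      rw [Nat.cast_succ] at h3
      simp [alive, h1, h3]

end Cusum

/-! ### Densities, marginal laws and likelihood ratios. -/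

section Densities

variable {L m : ℕ}

lemma IsPdf.integrable {p : ℝ → ℝ} (hp : IsPdf p) : Integrable p := by
  refine ⟨hp.measurable.aestronglyMeasurable, ?_⟩
  rw [hasFiniteIntegral_iff_ofReal (ae_of_all _ hp.nonneg), hp.lintegral_eq_one]
  exact ENNReal.one_lt_top

lemma IsPdf.integral_eq_one {p : ℝ → ℝ} (hp : IsPdf p) : ∫ x, p x = 1 := by
  rw [integral_eq_lintegral_of_nonneg_ae (ae_of_all _ hp.nonneg)
    hp.measurable.aestronglyMeasurable, hp.lintegral_eq_one, ENNReal.toReal_one]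

lemma lintegral_prod_pdf {p : Fin L → ℝ → ℝ} (hp : ∀ ℓ, IsPdf (p ℓ)) :
    ∫⁻ x : Fin L → ℝ, ∏ ℓ, ENNReal.ofReal (p ℓ (x ℓ)) = 1 := by
  have h : ∀ x : Fin L → ℝ, ∏ ℓ, ENNReal.ofReal (p ℓ (x ℓ)) = ENNReal.ofReal (∏ ℓ, p ℓ (x ℓ)) :=
    fun x => (ENNReal.ofReal_prod_of_nonneg fun ℓ _ => (hp ℓ).nonneg _).symm
  simp only [h]
  have hint : Integrable (fun x : Fin L → ℝ => ∏ ℓ, p ℓ (x ℓ)) volume :=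
    Integrable.fintype_prod fun ℓ => (hp ℓ).integrable
  rw [← ofReal_integral_eq_lintegral_ofReal hint
    (ae_of_all _ fun x => Finset.prod_nonneg fun ℓ _ => (hp ℓ).nonneg _),
    integral_fintype_prod_volume_eq_prod]
  simp [(hp _).integral_eq_one]

variable {g f : Fin L → ℝ → ℝ}

lemma postDensity_eq_prod (E : Placement L m) (x : Fin L → ℝ) :
    postDensity g f E x = ∏ ℓ, ENNReal.ofReal ((if ℓ ∈ E.1 then f ℓ else g ℓ) (x ℓ)) := by
  rw [← Finset.prod_mul_prod_compl E.1, postDensity]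
  congr 1
  · exact Finset.prod_congr rfl fun ℓ hℓ => by rw [if_pos hℓ]
  · exact Finset.prod_congr rfl fun ℓ hℓ => by rw [if_neg (Finset.mem_compl.1 hℓ)]

lemma isProbabilityMeasure_pre (hg : ∀ ℓ, IsPdf (g ℓ)) :
    IsProbabilityMeasure (volume.withDensity (preDensity g)) :=
  ⟨by rw [withDensity_apply _ .univ, Measure.restrict_univ]; exact lintegral_prod_pdf hg⟩

lemma isProbabilityMeasure_post (hg : ∀ ℓ, IsPdf (g ℓ)) (hf : ∀ ℓ, IsPdf (f ℓ))
    (E : Placement L m) : IsProbabilityMeasure (volume.withDensity (postDensity g f E)) := by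
  refine ⟨?_⟩
  rw [withDensity_apply _ .univ, Measure.restrict_univ]
  simp only [postDensity_eq_prod]
  exact lintegral_prod_pdf fun ℓ => by split_ifs; exacts [hf ℓ, hg ℓ]

/-- The laws of the observation vectors under `changeLaw`. -/
noncomputable def changeMarginal (g f : Fin L → ℝ → ℝ) (ν : ℕ) (S : ℕ → Placement L m) (n : ℕ) :
    Measure (Fin L → ℝ) :=
  volume.withDensity (if n + 1 ≤ ν then preDensity g else postDensity g f (S n))

lemma changeLaw_eq (ν : ℕ) (S : ℕ → Placement L m) :
    changeLaw g f ν S = Measure.infinitePi (changeMarginal g f ν S) := rfl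

lemma isProbabilityMeasure_changeMarginal (hg : ∀ ℓ, IsPdf (g ℓ)) (hf : ∀ ℓ, IsPdf (f ℓ))
    (ν : ℕ) (S : ℕ → Placement L m) (n : ℕ) : IsProbabilityMeasure (changeMarginal g f ν S n) := by
  unfold changeMarginal
  split_ifs
  exacts [isProbabilityMeasure_pre hg, isProbabilityMeasure_post hg hf _]

lemma changeMarginal_of_lt {ν n : ℕ} (h : n < ν) (S : ℕ → Placement L m) :
    changeMarginal g f ν S n = volume.withDensity (preDensity g) := by
  rw [changeMarginal, if_pos (by omega)]

lemma changeMarginal_of_le {ν n : ℕ} (h : ν ≤ n) (S : ℕ → Placement L m) :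
    changeMarginal g f ν S n = volume.withDensity (postDensity g f (S n)) := by
  rw [changeMarginal, if_neg (by omega)]

lemma preDensity_ne_top (x : Fin L → ℝ) : preDensity g x ≠ ∞ :=
  ENNReal.prod_ne_top fun _ _ => ENNReal.ofReal_ne_top

lemma postDensity_ne_top (E : Placement L m) (x : Fin L → ℝ) : postDensity g f E x ≠ ∞ :=
  ENNReal.mul_ne_top (ENNReal.prod_ne_top fun _ _ => ENNReal.ofReal_ne_top)
    (ENNReal.prod_ne_top fun _ _ => ENNReal.ofReal_ne_top)

/-- Clearing the denominator fails only where the pre-change density vanishes and the mixture does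
not; there the ratio is ∞, the left side is 0 · ∞ = 0, and the indicator removes the mixture on the
right. -/
lemma preDensity_mul_mixtureRatio (w : Placement L m → ℝ) (x : Fin L → ℝ) :
    preDensity g x * mixtureRatio g f w x
      = (Set.Iio ∞).indicator 1 (mixtureRatio g f w x)
        * ∑ E, ENNReal.ofReal (w E) * postDensity g f E x := by
  have hs : ∑ E, ENNReal.ofReal (w E) * postDensity g f E x ≠ ∞ :=
    ENNReal.sum_ne_top.2 fun E _ => ENNReal.mul_ne_top ENNReal.ofReal_ne_top (postDensity_ne_top E x)
  unfold mixtureRatio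
  set p := ∑ E, ENNReal.ofReal (w E) * postDensity g f E x
  rcases eq_or_ne (preDensity g x) 0 with h0 | h0
  · rcases eq_or_ne p 0 with hp | hp
    · simp [hp]
    · simp [h0, ENNReal.div_zero hp, Set.indicator]
  · have : p / preDensity g x < ∞ := ENNReal.div_lt_top hs h0
    rw [ENNReal.mul_div_cancel h0 (preDensity_ne_top x), Set.indicator_of_mem (by exact this)]
    simp

lemma mixtureRatio_eq_sum (w : Placement L m → ℝ) (x : Fin L → ℝ) :
    mixtureRatio g f w x
      = ∑ E, ENNReal.ofReal (w E) * (postDensity g f E x / preDensity g x) := by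
  simp only [mixtureRatio, div_eq_mul_inv, Finset.sum_mul, mul_assoc]

end Densities

/-! ### Exchangeability of the sensors and the tilting of the ratio law. -/

section Symmetry

variable {L m : ℕ} {g f : ℝ → ℝ}

lemma sum_uniformWeights (hmL : m ≤ L) :
    ∑ E, ENNReal.ofReal (uniformWeights L m E) = 1 := by
  have h : (L.choose m : ℝ) ≠ 0 := by exact_mod_cast (Nat.choose_pos hmL).ne'
  rw [← ENNReal.ofReal_sum_of_nonneg fun E _ => by unfold uniformWeights; positivity]
  have hc : Fintype.card (Placement L m) = L.choose m := by
    simp [Fintype.card_finset_len]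
  simp only [uniformWeights, Finset.sum_const, Finset.card_univ, hc, nsmul_eq_mul]
  rw [mul_one_div_cancel h, ENNReal.ofReal_one]

lemma postDensity_comp_perm (σ : Equiv.Perm (Fin L)) {E E' : Placement L m}
    (h : ∀ ℓ, σ ℓ ∈ E'.1 ↔ ℓ ∈ E.1) (x : Fin L → ℝ) :
    postDensity (fun _ => g) (fun _ => f) E (x ∘ σ)
      = postDensity (fun _ => g) (fun _ => f) E' x := by
  rw [postDensity_eq_prod, postDensity_eq_prod,
    ← Equiv.prod_comp σ fun ℓ => ENNReal.ofReal ((if ℓ ∈ E'.1 then f else g) (x ℓ))]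
  refine Finset.prod_congr rfl fun ℓ _ => ?_
  simp [h]

/-- The action of a permutation of the sensors on the placements. -/
def placementPerm (σ : Equiv.Perm (Fin L)) : Placement L m ≃ Placement L m :=
  (Equiv.finsetCongr σ).subtypeEquiv fun E => by simp

lemma mixtureRatio_comp_perm (σ : Equiv.Perm (Fin L)) (x : Fin L → ℝ) :
    mixtureRatio (fun _ => g) (fun _ => f) (uniformWeights L m) (x ∘ σ)
      = mixtureRatio (fun _ => g) (fun _ => f) (uniformWeights L m) x := by
  unfold mixtureRatio
  congr 1
  · refine Fintype.sum_equiv (placementPerm σ) _ _ fun E => ?_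
    rw [postDensity_comp_perm σ (E' := placementPerm σ E)]
    · rfl
    · intro ℓ
      simp [placementPerm]
  · simp only [preDensity, Function.comp_apply]
    exact Equiv.prod_comp σ fun ℓ => ENNReal.ofReal (g (x ℓ))

lemma exists_perm_placement (E E' : Placement L m) :
    ∃ σ : Equiv.Perm (Fin L), ∀ ℓ, σ ℓ ∈ E'.1 ↔ ℓ ∈ E.1 := by
  have e : {ℓ // ℓ ∈ E.1} ≃ {ℓ // ℓ ∈ E'.1} :=
    Fintype.equivOfCardEq (by simp [E.2, E'.2])
  refine ⟨e.extendSubtype, fun ℓ => ⟨fun h => ?_, fun h => e.extendSubtype_mem ℓ h⟩⟩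
  by_contra hn
  exact e.extendSubtype_not_mem ℓ hn h

lemma measurePreserving_comp_perm (σ : Equiv.Perm (Fin L)) :
    MeasurePreserving (fun x : Fin L → ℝ => x ∘ σ) volume volume := by
  have h := volume_measurePreserving_piCongrLeft (fun _ : Fin L => ℝ) σ.symm
  convert h using 1
  ext x ℓ
  have := Equiv.piCongrLeft_apply_apply (fun _ : Fin L => ℝ) σ.symm x (σ ℓ)
  rw [Equiv.symm_apply_apply] at this
  exact this.symm

variable (g f) in
/-- The likelihood ratio of the uniform mixture against the pre-change density. -/
noncomputable abbrev uniformRatio (L m : ℕ) : (Fin L → ℝ) → ℝ≥0∞ :=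
  mixtureRatio (fun _ => g) (fun _ => f) (uniformWeights L m)

/-- A permutation taking `E` to `E'` preserves Lebesgue measure and the uniform ratio. -/
lemma lintegral_comp_uniformRatio_mul (hg : Measurable g) (hf : Measurable f) {u : ℝ≥0∞ → ℝ≥0∞}
    (hu : Measurable u) (E E' : Placement L m) :
    ∫⁻ x, u (uniformRatio g f L m x) * postDensity (fun _ => g) (fun _ => f) E x
      = ∫⁻ x, u (uniformRatio g f L m x) * postDensity (fun _ => g) (fun _ => f) E' x := by
  obtain ⟨σ, hσ⟩ := exists_perm_placement E E'
  have hm : Measurable fun x => u (uniformRatio g f L m x)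
      * postDensity (fun _ => g) (fun _ => f) E x :=
    (hu.comp (measurable_mixtureRatio (fun _ => hg) fun _ => hf)).mul
      (measurable_postDensity (fun _ => hg) (fun _ => hf) E)
  rw [← (measurePreserving_comp_perm σ).lintegral_comp hm]
  simp only [uniformRatio, mixtureRatio_comp_perm, postDensity_comp_perm σ hσ]

lemma lintegral_comp_uniformRatio_mul_mixture (hmL : m ≤ L) (hg : Measurable g) (hf : Measurable f)
    {u : ℝ≥0∞ → ℝ≥0∞} (hu : Measurable u) (E : Placement L m) :
    ∫⁻ x, u (uniformRatio g f L m x) * postDensity (fun _ => g) (fun _ => f) E x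
      = ∫⁻ x, u (uniformRatio g f L m x) * ∑ E, ENNReal.ofReal (uniformWeights L m E)
          * postDensity (fun _ => g) (fun _ => f) E x := by
  have hm : ∀ E : Placement L m, Measurable fun x => u (uniformRatio g f L m x)
      * postDensity (fun _ => g) (fun _ => f) E x := fun E =>
    (hu.comp (measurable_mixtureRatio (fun _ => hg) fun _ => hf)).mul
      (measurable_postDensity (fun _ => hg) (fun _ => hf) E)
  simp only [Finset.mul_sum, mul_left_comm]
  rw [lintegral_finsetSum _ fun E _ => (hm E).const_mul _]
  simp only [lintegral_const_mul _ (hm _)]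
  rw [Finset.sum_congr rfl fun E' _ => by rw [lintegral_comp_uniformRatio_mul hg hf hu E' E],
    ← Finset.sum_mul, sum_uniformWeights hmL, one_mul]

variable (g f) in
/-- The law of the likelihood ratio of one observation vector before the change. -/
noncomputable def preRatioLaw (L m : ℕ) : Measure ℝ≥0∞ :=
  (volume.withDensity (preDensity fun _ : Fin L => g)).map (uniformRatio g f L m)

variable (g f) in
/-- The law of the likelihood ratio of one observation vector after the change. -/
noncomputable def postRatioLaw (E : Placement L m) : Measure ℝ≥0∞ :=
  (volume.withDensity (postDensity (fun _ => g) (fun _ => f) E)).map (uniformRatio g f L m)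

lemma lintegral_map_withDensity {p : (Fin L → ℝ) → ℝ≥0∞} {R : (Fin L → ℝ) → ℝ≥0∞}
    (hp : Measurable p) (hR : Measurable R) {u : ℝ≥0∞ → ℝ≥0∞} (hu : Measurable u) :
    ∫⁻ l, u l ∂(volume.withDensity p).map R = ∫⁻ x, u (R x) * p x := by
  rw [lintegral_map hu hR]
  exact (lintegral_withDensity_eq_lintegral_mul _ hp (hu.comp hR)).trans
    (lintegral_congr fun x => mul_comm _ _)

lemma map_withDensity_apply {p : (Fin L → ℝ) → ℝ≥0∞} {R : (Fin L → ℝ) → ℝ≥0∞} (hp : Measurable p)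
    (hR : Measurable R) {s : Set ℝ≥0∞} (hs : MeasurableSet s) :
    (volume.withDensity p).map R s = ∫⁻ x, s.indicator 1 (R x) * p x := by
  rw [← lintegral_indicator_one hs]
  exact lintegral_map_withDensity hp hR (Measurable.indicator measurable_const hs)

lemma postRatioLaw_eq (hg : Measurable g) (hf : Measurable f) (E E' : Placement L m) :
    postRatioLaw g f E = postRatioLaw g f E' := by
  have hR : Measurable (uniformRatio g f L m) :=
    measurable_mixtureRatio (fun _ => hg) fun _ => hf
  ext s hs
  rw [postRatioLaw, postRatioLaw,
    map_withDensity_apply (measurable_postDensity (fun _ => hg) (fun _ => hf) E) hR hs,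
    map_withDensity_apply (measurable_postDensity (fun _ => hg) (fun _ => hf) E') hR hs]
  exact lintegral_comp_uniformRatio_mul hg hf (Measurable.indicator measurable_const hs) E E'

/-- By symmetry the placement may be replaced by the mixture, whose density against the pre-change
law is the ratio itself. The possible atom at ∞ is excluded; it is harmless, since it kills the
recursion at once. -/
lemma restrict_postRatioLaw (hmL : m ≤ L) (hg : Measurable g) (hf : Measurable f)
    (E : Placement L m) :
    (postRatioLaw g f E).restrict (Set.Iio ∞) = (preRatioLaw g f L m).withDensity fun l => l := by
  have hR : Measurable (uniformRatio g f L m) :=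
    measurable_mixtureRatio (fun _ => hg) fun _ => hf
  ext s hs
  have hm : Measurable fun l => s.indicator (1 : ℝ≥0∞ → ℝ≥0∞) l * l :=
    (Measurable.indicator measurable_const hs).mul measurable_id'
  rw [Measure.restrict_apply hs, postRatioLaw,
    map_withDensity_apply (measurable_postDensity (fun _ => hg) (fun _ => hf) E) hR
      (hs.inter measurableSet_Iio),
    lintegral_comp_uniformRatio_mul_mixture (u := (s ∩ Set.Iio ∞).indicator 1) hmL hg hf
      (Measurable.indicator measurable_const (hs.inter measurableSet_Iio)),
    withDensity_apply _ hs, ← lintegral_indicator hs]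
  have h1 : ∀ l, s.indicator (fun l : ℝ≥0∞ => l) l = s.indicator (1 : ℝ≥0∞ → ℝ≥0∞) l * l :=
    fun l => by by_cases hl : l ∈ s <;> simp [hl]
  simp only [h1]
  rw [preRatioLaw, lintegral_map_withDensity (measurable_preDensity fun _ => hg) hR hm]
  refine lintegral_congr fun x => ?_
  have h2 := preDensity_mul_mixtureRatio (g := fun _ => g) (f := fun _ => f) (uniformWeights L m) x
  rw [Set.inter_indicator_one, Pi.mul_apply, mul_assoc, mul_assoc, ← h2,
    mul_comm (preDensity _ x)]

end Symmetry

/-! ### False alarm rate and worst-case delay of the test. -/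

section Performance

variable {L m : ℕ} {g f : ℝ → ℝ} {b : ℝ}

lemma MTFA_eq_tsum {τ : Obs L → ℕ∞} (hτ : IsStoppingTime (obsFiltration L) τ)
    (g : Fin L → ℝ → ℝ) : MTFA g τ = ∑' k, ∫⁻ ω, alive τ k ω ∂noChangeLaw g := by
  rw [MTFA, ← lintegral_tsum fun k => (measurable_alive_pi hτ k).aemeasurable]
  refine lintegral_congr fun ω => ?_
  have h := delay_eq_tsum τ 0 ω
  simpa using h

lemma MTFA_cusumTime (hg : IsPdf g) (hf : IsPdf f) (b : ℝ) :
    MTFA (fun _ : Fin L => g) (cusumTime (fun _ => g) (fun _ => f) (uniformWeights L m) b)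
      = meanRunLength (preRatioLaw g f L m) (ENNReal.ofReal (Real.exp b)) 0 := by
  have hgm : ∀ _ : Fin L, Measurable g := fun _ => hg.measurable
  have hfm : ∀ _ : Fin L, Measurable f := fun _ => hf.measurable
  have := isProbabilityMeasure_pre (L := L) (g := fun _ => g) fun _ => hg
  rw [MTFA_eq_tsum (isStoppingTime_cusumTime hgm hfm b), meanRunLength]
  refine tsum_congr fun n => ?_
  have h := lintegral_mul_alive_cusumTime (w := uniformWeights L m) (b := b)
    (μ := fun _ => volume.withDensity (preDensity fun _ : Fin L => g)) hgm hfm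
    (ρ := preRatioLaw g f L m) n 0 (fun _ _ => rfl) (fun _ => 1) measurable_const
  simp only [one_mul, zero_add, cusumStat_zero, alive_zero (one_le_cusumTime b)] at h
  rw [noChangeLaw, h, lintegral_const, measure_univ, mul_one]

lemma WADD_cusumTime_le (hg : IsPdf g) (hf : IsPdf f) (b : ℝ) (E : Placement L m) :
    WADD (fun _ => g) (fun _ => f) m
        (cusumTime (fun _ => g) (fun _ => f) (uniformWeights L m) b)
      ≤ meanRunLength (postRatioLaw g f E) (ENNReal.ofReal (Real.exp b)) 0 := by
  have hgm : ∀ _ : Fin L, Measurable g := fun _ => hg.measurable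
  have hfm : ∀ _ : Fin L, Measurable f := fun _ => hf.measurable
  have hst := isStoppingTime_cusumTime (w := uniformWeights L m) hgm hfm b
  refine iSup₂_le fun S ν => ?_
  have := isProbabilityMeasure_changeMarginal (L := L) (fun _ => hg) (fun _ => hf) ν S
  have : IsProbabilityMeasure (changeLaw (fun _ => g) (fun _ => f) ν S) := by
    rw [changeLaw_eq]; infer_instance
  refine condDelay_le hst (one_le_meanRunLength _) fun φ hφ => ?_
  have hφm : Measurable φ := hφ.mono ((obsFiltration L).le ν) le_rfl
  have hρ : ∀ j, ν ≤ j → (changeMarginal (fun _ => g) (fun _ => f) ν S j).map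
      (mixtureRatio (fun _ => g) (fun _ => f) (uniformWeights L m)) = postRatioLaw g f E :=
    fun j hj => by
      rw [changeMarginal_of_le hj, postRatioLaw_eq hg.measurable hf.measurable E (S j)]; rfl
  simp only [delay_eq_tsum, ← ENNReal.tsum_mul_left, mul_assoc, alive_mul_alive (Nat.le_add_right ν _)]
  rw [lintegral_tsum fun n => (hφm.fun_mul (measurable_alive_pi hst _)).aemeasurable, meanRunLength,
    ← ENNReal.tsum_mul_right, changeLaw_eq]
  refine ENNReal.tsum_le_tsum fun n => ?_
  rw [lintegral_mul_alive_cusumTime hgm hfm n ν hρ φ hφ,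
    ← lintegral_const_mul _ (hφm.fun_mul (measurable_alive_pi hst _))]
  refine lintegral_mono fun ω => ?_
  rw [mul_comm]
  gcongr
  -- The worst past leaves the statistic at 0, where survival is most likely.
  exact antitone_survival n zero_le

end Performance

/-! ### The lower bound for an arbitrary stopping time. -/

section LowerBound

variable {L m : ℕ} {g f : ℝ → ℝ} {τ : Obs L → ℕ∞} {ν : ℕ}

lemma lintegral_changeLaw_le (hg : IsPdf g) (hf : IsPdf f) (S : ℕ → Placement L m)
    {φ : Obs L → ℝ≥0∞} (hφ : Measurable[obsFiltration L ν] φ) :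
    ∫⁻ ω, φ ω ∂changeLaw (fun _ => g) (fun _ => f) ν S
      ≤ ∫⁻ ω, φ ω ∂noChangeLaw fun _ => g := by
  have := isProbabilityMeasure_changeMarginal (L := L) (fun _ => hg) (fun _ => hf) ν S
  have := isProbabilityMeasure_pre (L := L) (g := fun _ => g) fun _ => hg
  have h := lintegral_mul_prod_le (μ := changeMarginal (fun _ => g) (fun _ => f) ν S)
    (μ' := fun _ => volume.withDensity (preDensity fun _ => g))
    -- The two laws agree before ν; density 0 afterwards makes the domination trivial there.
    (r := fun j _ => if j < ν then 1 else 0) (fun j => measurable_const) (fun j => ?_) ν φ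
    (hφ.mono ((obsFiltration L).le ν) le_rfl) (dependsOn_of_measurable hφ)
  · refine le_trans (le_of_eq (lintegral_congr fun ω => ?_)) h
    rw [Finset.prod_congr rfl fun j hj => if_pos (Finset.mem_range.1 hj)]
    simp
  · split_ifs with hj
    · rw [changeMarginal_of_lt hj]
      exact (withDensity_one (μ := volume.withDensity (preDensity fun _ : Fin L => g))).le
    · exact (withDensity_zero (μ := changeMarginal (fun _ => g) (fun _ => f) ν S j)).trans_le
        (Measure.zero_le _)

lemma lintegral_mul_prod_le_changeLaw (hg : IsPdf g) (hf : IsPdf f) (S : ℕ → Placement L m) {k : ℕ}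
    (hk : ν ≤ k) {ψ : Obs L → ℝ≥0∞} (hψ : Measurable[obsFiltration L k] ψ) :
    ∫⁻ ω, ψ ω * ∏ j ∈ Finset.Ico ν k, (postDensity (fun _ => g) (fun _ => f) (S j) (ω j)
        / preDensity (fun _ => g) (ω j)) ∂noChangeLaw (fun _ => g)
      ≤ ∫⁻ ω, ψ ω ∂changeLaw (fun _ => g) (fun _ => f) ν S := by
  have := isProbabilityMeasure_changeMarginal (L := L) (fun _ => hg) (fun _ => hf) ν S
  have := isProbabilityMeasure_pre (L := L) (g := fun _ => g) fun _ => hg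
  have hgm : ∀ _ : Fin L, Measurable g := fun _ => hg.measurable
  have hfm : ∀ _ : Fin L, Measurable f := fun _ => hf.measurable
  have hr : ∀ j, Measurable fun x : Fin L → ℝ =>
      postDensity (fun _ => g) (fun _ => f) (S j) x / preDensity (fun _ => g) x := fun j =>
    (measurable_postDensity hgm hfm (S j)).div (measurable_preDensity hgm)
  have h := lintegral_mul_prod_le (μ := fun _ => volume.withDensity (preDensity fun _ => g))
    (μ' := changeMarginal (fun _ => g) (fun _ => f) ν S)
    (r := fun j x => if j < ν then 1 else
      postDensity (fun _ => g) (fun _ => f) (S j) x / preDensity (fun _ => g) x)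
    (fun j => ?_) (fun j => ?_) k ψ
    (hψ.mono ((obsFiltration L).le k) le_rfl) (dependsOn_of_measurable hψ)
  · refine le_trans (le_of_eq (lintegral_congr fun ω => ?_)) h
    rw [← Finset.prod_range_mul_prod_Ico _ hk,
      Finset.prod_congr rfl fun j hj => if_pos (Finset.mem_range.1 hj), Finset.prod_const_one,
      one_mul, Finset.prod_congr rfl fun j hj => (if_neg (Finset.mem_Ico.1 hj).1.not_gt).symm]
  · split_ifs
    exacts [measurable_const, hr j]
  · split_ifs with hj
    · rw [changeMarginal_of_lt hj]
      exact (withDensity_one (μ := volume.withDensity (preDensity fun _ : Fin L => g))).le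
    · rw [changeMarginal_of_le (not_lt.1 hj), ← withDensity_mul _ (measurable_preDensity hgm) (hr j)]
      refine withDensity_mono (ae_of_all _ fun x => ?_)
      -- Only an inequality holds in general: post-change mass where the pre-change density vanishes
      -- is lost.
      exact ENNReal.mul_div_le

/-- The delay of any stopping time under a given path bounds a likelihood ratio sum. -/
lemma lintegral_path_le (hg : IsPdf g) (hf : IsPdf f)
    (hτ : IsStoppingTime (obsFiltration L) τ) (n : ℕ)
    {φ : Obs L → ℝ≥0∞} (hφ : Measurable[obsFiltration L ν] φ) (S : ℕ → Placement L m) :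
    ∑ k ∈ Finset.Ico ν n, ∫⁻ ω, φ ω * alive τ k ω * ∏ j ∈ Finset.Ico ν k,
        (postDensity (fun _ => g) (fun _ => f) (S j) (ω j) / preDensity (fun _ => g) (ω j))
        ∂noChangeLaw (fun _ => g)
      ≤ WADD (fun _ => g) (fun _ => f) m τ
        * ∫⁻ ω, φ ω * alive τ ν ω ∂noChangeLaw fun _ => g := by
  have := isProbabilityMeasure_changeMarginal (L := L) (fun _ => hg) (fun _ => hf) ν S
  have : IsProbabilityMeasure (changeLaw (fun _ => g) (fun _ => f) ν S) := by
    rw [changeLaw_eq]; infer_instance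
  have hφm : Measurable φ := hφ.mono ((obsFiltration L).le ν) le_rfl
  have hle : condDelay (fun _ => g) (fun _ => f) τ ν S ≤ WADD (fun _ => g) (fun _ => f) m τ :=
    le_iSup₂ (f := fun S ν => condDelay (fun _ => g) (fun _ => f) τ ν S) S ν
  calc _ ≤ ∑ k ∈ Finset.Ico ν n, ∫⁻ ω, φ ω * alive τ k ω
          ∂changeLaw (fun _ => g) (fun _ => f) ν S := by
        refine Finset.sum_le_sum fun k hk => ?_
        have hνk := (Finset.mem_Ico.1 hk).1
        exact lintegral_mul_prod_le_changeLaw hg hf S hνk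
          ((hφ.mono ((obsFiltration L).mono hνk) le_rfl).mul (measurable_alive hτ k))
    _ ≤ ∫⁻ ω, φ ω * alive τ ν ω * ((τ ω : ℝ≥0∞) - (ν : ℝ≥0∞))
          ∂changeLaw (fun _ => g) (fun _ => f) ν S := by
        rw [← lintegral_finsetSum _ fun k _ => hφm.fun_mul (measurable_alive_pi hτ k)]
        refine lintegral_mono fun ω => ?_
        rw [mul_assoc, ← Finset.mul_sum, delay_eq_tsum, ← ENNReal.tsum_mul_left]
        gcongr
        rw [Finset.sum_Ico_eq_sum_range]
        simp only [alive_mul_alive (Nat.le_add_right ν _)]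
        exact ENNReal.sum_le_tsum _
    _ ≤ WADD (fun _ => g) (fun _ => f) m τ
          * ∫⁻ ω, φ ω * alive τ ν ω ∂changeLaw (fun _ => g) (fun _ => f) ν S :=
        lintegral_delay_le hτ hle hφ
    _ ≤ _ := by
        refine mul_le_mul' le_rfl ?_
        exact lintegral_changeLaw_le hg hf S (hφ.mul (measurable_alive hτ ν))

/-- Averaging over independent paths turns products of likelihood ratios of placements into
products of mixture ratios. -/
lemma prod_sum_weights {ι X : Type*} [Fintype ι] (c : ι → ℝ≥0∞) (hc : ∑ E, c E = 1)
    (r : ι → X → ℝ≥0∞) {ν k n : ℕ} (hk : k ≤ n) (ω : ℕ → X) (S : (Fin n → ι) → ℕ → ι)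
    (hS : ∀ T (i : Fin n), S T i = T i) :
    ∏ j ∈ Finset.Ico ν k, ∑ E, c E * r E (ω j)
      = ∑ T : Fin n → ι, (∏ i, c (T i)) * ∏ j ∈ Finset.Ico ν k, r (S T j) (ω j) := by
  classical
  have hprod : ∀ a : ℕ → ℝ≥0∞, ∏ j ∈ Finset.Ico ν k, a j
      = ∏ i : Fin n, if (i : ℕ) ∈ Finset.Ico ν k then a i else 1 := fun a => by
    rw [Fin.prod_univ_eq_prod_range (fun i => if i ∈ Finset.Ico ν k then a i else 1) n,
      Finset.prod_ite_mem, Finset.inter_eq_right.2]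
    intro j hj
    rw [Finset.mem_Ico] at hj
    rw [Finset.mem_range]
    omega
  have hfac : ∀ i : Fin n, (if (i : ℕ) ∈ Finset.Ico ν k then ∑ E, c E * r E (ω i) else 1)
      = ∑ E, c E * if (i : ℕ) ∈ Finset.Ico ν k then r E (ω i) else 1 := fun i => by
    split_ifs
    · rfl
    · simp [hc]
  rw [hprod, Finset.prod_congr rfl fun i _ => hfac i, Finset.prod_univ_sum, Fintype.piFinset_univ]
  refine Finset.sum_congr rfl fun T _ => ?_
  rw [Finset.prod_mul_distrib, hprod]
  simp only [hS]

/-- The bound for each path is averaged over independent uniform placements. With horizon `n` this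
is a finite sum; `E₀` only pads the paths beyond it. -/
lemma lintegral_mixture_le (hmL : m ≤ L) (hg : IsPdf g) (hf : IsPdf f)
    (hτ : IsStoppingTime (obsFiltration L) τ) (E₀ : Placement L m) (n : ℕ)
    {φ : Obs L → ℝ≥0∞} (hφ : Measurable[obsFiltration L ν] φ) :
    ∑ k ∈ Finset.Ico ν n, ∫⁻ ω, φ ω * alive τ k ω * ∏ j ∈ Finset.Ico ν k,
        uniformRatio g f L m (ω j) ∂noChangeLaw (fun _ => g)
      ≤ WADD (fun _ => g) (fun _ => f) m τ
        * ∫⁻ ω, φ ω * alive τ ν ω ∂noChangeLaw fun _ => g := by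
  have hgm : ∀ _ : Fin L, Measurable g := fun _ => hg.measurable
  have hfm : ∀ _ : Fin L, Measurable f := fun _ => hf.measurable
  have hφm : Measurable φ := hφ.mono ((obsFiltration L).le ν) le_rfl
  set c : Placement L m → ℝ≥0∞ := fun E => ENNReal.ofReal (uniformWeights L m E) with hc
  set r : Placement L m → (Fin L → ℝ) → ℝ≥0∞ := fun E x =>
    postDensity (fun _ => g) (fun _ => f) E x / preDensity (fun _ => g) x with hr
  have hrm : ∀ E, Measurable (r E) := fun E =>
    (measurable_postDensity hgm hfm E).div (measurable_preDensity hgm)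
  have hc1 : ∑ E, c E = 1 := sum_uniformWeights hmL
  let S : (Fin n → Placement L m) → ℕ → Placement L m := fun T j =>
    if h : j < n then T ⟨j, h⟩ else E₀
  have hS : ∀ T (i : Fin n), S T i = T i := fun T i => by simp [S]
  have hm : ∀ T k, Measurable fun ω : Obs L =>
      φ ω * alive τ k ω * ∏ j ∈ Finset.Ico ν k, r (S T j) (ω j) := fun T k =>
    (hφm.mul (measurable_alive_pi hτ k)).mul
      (Finset.measurable_prod _ fun j _ => (hrm _).comp (measurable_pi_apply j))
  have hterm : ∀ k ∈ Finset.Ico ν n,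
      ∫⁻ ω, φ ω * alive τ k ω * ∏ j ∈ Finset.Ico ν k, uniformRatio g f L m (ω j)
          ∂noChangeLaw (fun _ => g)
        = ∑ T : Fin n → Placement L m, (∏ i, c (T i)) * ∫⁻ ω, φ ω * alive τ k ω
            * ∏ j ∈ Finset.Ico ν k, r (S T j) (ω j) ∂noChangeLaw fun _ => g := by
    intro k hk
    simp only [← lintegral_const_mul _ (hm _ k)]
    rw [← lintegral_finsetSum _ fun T _ => (hm T k).const_mul _]
    refine lintegral_congr fun ω => ?_
    have h := prod_sum_weights c hc1 r (ν := ν) (Finset.mem_Ico.1 hk).2.le ω S hS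
    simp only [uniformRatio, mixtureRatio_eq_sum]
    rw [show ∏ j ∈ Finset.Ico ν k, ∑ E, ENNReal.ofReal (uniformWeights L m E)
      * (postDensity (fun _ => g) (fun _ => f) E (ω j) / preDensity (fun _ => g) (ω j)) = _ from h,
      Finset.mul_sum]
    exact Finset.sum_congr rfl fun T _ => mul_left_comm _ _ _
  rw [Finset.sum_congr rfl hterm, Finset.sum_comm]
  have hw : ∑ T : Fin n → Placement L m, ∏ i, c (T i) = 1 := by
    rw [← Fintype.piFinset_univ, ← Finset.prod_univ_sum]
    simp [hc1]
  calc _ = ∑ T : Fin n → Placement L m, (∏ i, c (T i)) * ∑ k ∈ Finset.Ico ν n,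
          ∫⁻ ω, φ ω * alive τ k ω * ∏ j ∈ Finset.Ico ν k, r (S T j) (ω j)
            ∂noChangeLaw fun _ => g := by simp only [Finset.mul_sum]
    _ ≤ ∑ T : Fin n → Placement L m, (∏ i, c (T i)) * (WADD (fun _ => g) (fun _ => f) m τ
        * ∫⁻ ω, φ ω * alive τ ν ω ∂noChangeLaw (fun _ => g)) := by
        gcongr with T
        exact lintegral_path_le hg hf hτ n hφ (S T)
    _ = _ := by rw [← Finset.sum_mul, hw, one_mul]

/-- Lower bound for the worst-case delay in terms of Page's statistic before the change. -/
lemma sum_lintegral_max_le (hmL : m ≤ L) (hg : IsPdf g) (hf : IsPdf f)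
    (hτ : IsStoppingTime (obsFiltration L) τ) (E₀ : Placement L m) (n : ℕ) :
    ∑ k ∈ Finset.range n, ∫⁻ ω, alive τ k ω
        * max (cusumStat (fun _ => g) (fun _ => f) (uniformWeights L m) k ω) 1
        ∂noChangeLaw (fun _ => g)
      ≤ WADD (fun _ => g) (fun _ => f) m τ * ∑ k ∈ Finset.range n, ∫⁻ ω,
        (1 - cusumStat (fun _ => g) (fun _ => f) (uniformWeights L m) k ω) * alive τ k ω
          ∂noChangeLaw fun _ => g := by
  have hgm : ∀ _ : Fin L, Measurable g := fun _ => hg.measurable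
  have hfm : ∀ _ : Fin L, Measurable f := fun _ => hf.measurable
  have hW := fun k => measurable_cusumStat (w := uniformWeights L m) hgm hfm k
  have hR : Measurable (uniformRatio g f L m) := measurable_mixtureRatio hgm hfm
  have hφ := fun k => (measurable_const (a := (1 : ℝ≥0∞))).sub (hW k)
  have hterm : ∀ k, ∫⁻ ω, alive τ k ω
        * max (cusumStat (fun _ => g) (fun _ => f) (uniformWeights L m) k ω) 1
        ∂noChangeLaw (fun _ => g)
      = ∑ ν ∈ Finset.range (k + 1), ∫⁻ ω,
          (1 - cusumStat (fun _ => g) (fun _ => f) (uniformWeights L m) ν ω) * alive τ k ω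
            * ∏ j ∈ Finset.Ico ν k, uniformRatio g f L m (ω j) ∂noChangeLaw fun _ => g := by
    intro k
    rw [← lintegral_finsetSum]
    · refine lintegral_congr fun ω => ?_
      rw [max_cusumStat_eq_sum, Finset.mul_sum]
      exact Finset.sum_congr rfl fun ν _ => by ring
    · intro ν _
      exact ((((hφ ν).mono ((obsFiltration L).le ν) le_rfl)).mul (measurable_alive_pi hτ k)).mul
        (Finset.measurable_prod _ fun j _ => hR.comp (measurable_pi_apply j))
  rw [Finset.sum_congr rfl fun k _ => hterm k, Finset.mul_sum,
    Finset.sum_comm' (s := Finset.range n) (t := fun k => Finset.range (k + 1))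
      (t' := Finset.range n) (s' := fun ν => Finset.Ico ν n)]
  · exact Finset.sum_le_sum fun ν _ => lintegral_mixture_le hmL hg hf hτ E₀ n (hφ ν)
  · intro k ν
    simp only [Finset.mem_range, Finset.mem_Ico]
    omega

/-- The Lagrangian inequality: no stopping time does better than the threshold rule. -/
lemma sum_lintegral_drift_le (hmL : m ≤ L) (hg : IsPdf g) (hf : IsPdf f)
    (hτ : IsStoppingTime (obsFiltration L) τ) (E : Placement L m) {B : ℝ≥0∞}
    (hB : 1 ≤ B) (hB' : B ≠ ∞) (ha : meanRunLength (preRatioLaw g f L m) B 0 ≠ ∞) (n : ℕ) :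
    meanRunLength (postRatioLaw g f E) B 0 * (∑ k ∈ Finset.range n, ∫⁻ ω,
        (1 - cusumStat (fun _ => g) (fun _ => f) (uniformWeights L m) k ω) * alive τ k ω
          ∂noChangeLaw (fun _ => g))
      + multiplier (preRatioLaw g f L m) (postRatioLaw g f E) B
        * (∑ k ∈ Finset.range n, ∫⁻ ω, alive τ k ω ∂noChangeLaw (fun _ => g))
      + ∫⁻ ω, alive τ n ω * potential (preRatioLaw g f L m) (postRatioLaw g f E) B
          (cusumStat (fun _ => g) (fun _ => f) (uniformWeights L m) n ω) ∂noChangeLaw (fun _ => g)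
      ≤ (∑ k ∈ Finset.range n, ∫⁻ ω, alive τ k ω
          * max (cusumStat (fun _ => g) (fun _ => f) (uniformWeights L m) k ω) 1
          ∂noChangeLaw (fun _ => g))
        + multiplier (preRatioLaw g f L m) (postRatioLaw g f E) B
          * meanRunLength (preRatioLaw g f L m) B 0 := by
  have hgm : ∀ _ : Fin L, Measurable g := fun _ => hg.measurable
  have hfm : ∀ _ : Fin L, Measurable f := fun _ => hf.measurable
  have hW := fun k => measurable_cusumStat_pi (w := uniformWeights L m) hgm hfm k
  have := isProbabilityMeasure_pre (L := L) (g := fun _ => g) fun _ => hg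
  have : IsProbabilityMeasure (noChangeLaw fun _ : Fin L => g) := by
    unfold noChangeLaw; infer_instance
  have htilt := restrict_postRatioLaw hmL hg.measurable hf.measurable E
  set ρ := preRatioLaw g f L m with hρ
  set d := meanRunLength (postRatioLaw g f E) B 0
  set c := multiplier ρ (postRatioLaw g f E) B
  set U := potential ρ (postRatioLaw g f E) B
  set W := cusumStat (fun _ : Fin L => g) (fun _ => f) (uniformWeights L m)
  set P := noChangeLaw fun _ : Fin L => g with hP
  have hU : Measurable U := measurable_potential
  have hal := measurable_alive_pi hτ
  induction n with
  | zero =>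
    simp only [Finset.range_zero, Finset.sum_empty, mul_zero, zero_add]
    calc ∫⁻ ω, alive τ 0 ω * U (W 0 ω) ∂P ≤ ∫⁻ _, c * meanRunLength ρ B 0 ∂P := by
          refine lintegral_mono fun ω => ?_
          calc alive τ 0 ω * U (W 0 ω) ≤ 1 * U 0 := by
                rw [show W 0 ω = 0 from cusumStat_zero ω]
                gcongr
                exact alive_le_one 0 ω
            _ ≤ _ := by rw [one_mul]; exact potential_zero_le
      _ = _ := by rw [lintegral_const, measure_univ, mul_one]
  | succ n ih =>
    -- One step of the drift inequality, integrated on {τ > n}; stopping only discards nonnegative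
    -- potential.
    have hstep : d * (∫⁻ ω, (1 - W n ω) * alive τ n ω ∂P) + c * (∫⁻ ω, alive τ n ω ∂P)
          + ∫⁻ ω, alive τ (n + 1) ω * U (W (n + 1) ω) ∂P
        ≤ ∫⁻ ω, alive τ n ω * max (W n ω) 1 ∂P + ∫⁻ ω, alive τ n ω * U (W n ω) ∂P := by
      have h1 : ∫⁻ ω, alive τ (n + 1) ω * U (W (n + 1) ω) ∂P
          ≤ ∫⁻ ω, alive τ n ω * ∫⁻ l, U (max (W n ω) 1 * l) ∂ρ ∂P := by
        refine le_trans (lintegral_mono fun ω => ?_) (le_of_eq (lintegral_mul_cusumStat_succ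
          (μ := fun _ => volume.withDensity (preDensity fun _ : Fin L => g))
          hgm hfm (measurable_alive hτ n) hU))
        gcongr
        exact alive_anti n.le_succ ω
      have hm1 : Measurable fun ω => (1 - W n ω) * alive τ n ω :=
        (measurable_const.sub (hW n)).mul (hal n)
      rw [← lintegral_const_mul _ hm1, ← lintegral_const_mul _ (hal n)]
      refine (add_le_add_right h1 _).trans ?_
      rw [← lintegral_add_left (hm1.const_mul d), ← lintegral_add_left
        ((hm1.const_mul d).fun_add ((hal n).const_mul c)), ← lintegral_add_left
        ((hal n).fun_mul ((hW n).max measurable_const))]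
      refine lintegral_mono fun ω => ?_
      calc d * ((1 - W n ω) * alive τ n ω) + c * alive τ n ω
            + alive τ n ω * ∫⁻ l, U (max (W n ω) 1 * l) ∂ρ
          = alive τ n ω * (d * (1 - W n ω) + c + ∫⁻ l, U (max (W n ω) 1 * l) ∂ρ) := by ring
        _ ≤ alive τ n ω * (max (W n ω) 1 + U (W n ω)) := by
            exact mul_le_mul' le_rfl (drift_le htilt hB hB' ha _)
        _ = _ := mul_add _ _ _
    simp only [Finset.sum_range_succ]
    set A := ∑ k ∈ Finset.range n, ∫⁻ ω, (1 - W k ω) * alive τ k ω ∂P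
    set T := ∑ k ∈ Finset.range n, ∫⁻ ω, alive τ k ω ∂P
    set N := ∑ k ∈ Finset.range n, ∫⁻ ω, alive τ k ω * max (W k ω) 1 ∂P
    calc d * (A + ∫⁻ ω, (1 - W n ω) * alive τ n ω ∂P) + c * (T + ∫⁻ ω, alive τ n ω ∂P)
          + ∫⁻ ω, alive τ (n + 1) ω * U (W (n + 1) ω) ∂P
        = d * A + c * T + (d * (∫⁻ ω, (1 - W n ω) * alive τ n ω ∂P) + c * (∫⁻ ω, alive τ n ω ∂P)
          + ∫⁻ ω, alive τ (n + 1) ω * U (W (n + 1) ω) ∂P) := by ring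
      _ ≤ d * A + c * T + (∫⁻ ω, alive τ n ω * max (W n ω) 1 ∂P
            + ∫⁻ ω, alive τ n ω * U (W n ω) ∂P) := by gcongr
      _ = (d * A + c * T + ∫⁻ ω, alive τ n ω * U (W n ω) ∂P)
            + ∫⁻ ω, alive τ n ω * max (W n ω) 1 ∂P := by ring
      _ ≤ (N + c * meanRunLength ρ B 0) + ∫⁻ ω, alive τ n ω * max (W n ω) 1 ∂P := by gcongr
      _ = _ := by ring

/-- No stopping time whose mean time to false alarm is at least that of the threshold rule has a
smaller worst-case delay. -/
lemma meanRunLength_le_WADD (hmL : m ≤ L) (hg : IsPdf g) (hf : IsPdf f)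
    (hτ : IsStoppingTime (obsFiltration L) τ) (hτ1 : ∀ ω, 1 ≤ τ ω) (E : Placement L m) {B : ℝ≥0∞}
    (hB : 1 ≤ B) (hB' : B ≠ ∞) (ha : meanRunLength (preRatioLaw g f L m) B 0 ≠ ∞)
    (hM : meanRunLength (preRatioLaw g f L m) B 0 ≤ MTFA (fun _ => g) τ) :
    meanRunLength (postRatioLaw g f E) B 0 ≤ WADD (fun _ => g) (fun _ => f) m τ := by
  have := isProbabilityMeasure_pre (L := L) (g := fun _ => g) fun _ => hg
  have : IsProbabilityMeasure (noChangeLaw fun _ : Fin L => g) := by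
    unfold noChangeLaw; infer_instance
  have htilt := restrict_postRatioLaw hmL hg.measurable hf.measurable E
  have hc := multiplier_ne_top htilt hB hB' ha
  set c := multiplier (preRatioLaw g f L m) (postRatioLaw g f E) B
  set a := meanRunLength (preRatioLaw g f L m) B 0
  set d := meanRunLength (postRatioLaw g f E) B 0
  set D := WADD (fun _ => g) (fun _ => f) m τ
  set P := noChangeLaw fun _ : Fin L => g with hP
  set W := cusumStat (fun _ : Fin L => g) (fun _ => f) (uniformWeights L m)
  by_contra! hlt
  set A : ℕ → ℝ≥0∞ := fun n => ∑ k ∈ Finset.range n, ∫⁻ ω, (1 - W k ω) * alive τ k ω ∂P with hA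
  set T : ℕ → ℝ≥0∞ := fun n => ∑ k ∈ Finset.range n, ∫⁻ ω, alive τ k ω ∂P with hT
  have hAfin : ∀ n, A n ≠ ∞ := fun n => by
    refine ENNReal.sum_ne_top.2 fun k _ => ne_top_of_le_ne_top ENNReal.one_ne_top ?_
    calc ∫⁻ ω, (1 - W k ω) * alive τ k ω ∂P ≤ ∫⁻ _, 1 ∂P :=
          lintegral_mono fun ω => mul_le_one' tsub_le_self (alive_le_one k ω)
      _ = 1 := by simp
  have hAone : ∀ n, 1 ≤ A (n + 1) := fun n => by
    calc (1 : ℝ≥0∞) = ∫⁻ ω, (1 - W 0 ω) * alive τ 0 ω ∂P := by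
          simp [W, cusumStat_zero, alive_zero hτ1]
      _ ≤ A (n + 1) := Finset.single_le_sum
          (f := fun k => ∫⁻ ω, (1 - W k ω) * alive τ k ω ∂P) (fun _ _ => zero_le) (by simp)
  have hkey : ∀ n, (d - D) + c * T (n + 1) ≤ c * a := fun n => by
    have h1 := sum_lintegral_drift_le hmL hg hf hτ E hB hB' ha (n + 1)
    have h2 := sum_lintegral_max_le hmL hg hf hτ E (n + 1)
    have h3 : d * A (n + 1) + c * T (n + 1) ≤ D * A (n + 1) + c * a :=
      (le_self_add.trans h1).trans (by gcongr)
    refine (ENNReal.add_le_add_iff_left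
      (ENNReal.mul_ne_top (ne_top_of_lt hlt) (hAfin (n + 1)))).1 (le_trans ?_ h3)
    calc D * A (n + 1) + (d - D + c * T (n + 1))
        = D * A (n + 1) + (d - D) * 1 + c * T (n + 1) := by ring
      _ ≤ D * A (n + 1) + (d - D) * A (n + 1) + c * T (n + 1) := by
          gcongr
          exact hAone n
      _ = d * A (n + 1) + c * T (n + 1) := by rw [← add_mul, add_tsub_cancel_of_le hlt.le]
  have hlim : (d - D) + c * MTFA (fun _ => g) τ ≤ c * a := by
    have hTlim : Filter.Tendsto T Filter.atTop (nhds (MTFA (fun _ => g) τ)) := by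
      rw [MTFA_eq_tsum hτ]
      exact ENNReal.tendsto_nat_tsum _
    have h := ((ENNReal.Tendsto.const_mul hTlim (Or.inr hc)).const_add (d - D)).comp
      (Filter.tendsto_add_atTop_nat 1)
    exact le_of_tendsto' h hkey
  have hpos : 0 < d - D := tsub_pos_of_lt hlt
  have hfin : c * a ≠ ∞ := ENNReal.mul_ne_top hc ha
  have : c * a < c * a := by
    calc c * a < (d - D) + c * a := by
          rw [add_comm]; exact ENNReal.lt_add_right hfin hpos.ne'
      _ ≤ (d - D) + c * MTFA (fun _ => g) τ := by gcongr
      _ ≤ c * a := hlim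
  exact lt_irrefl _ this

end LowerBound

end MovingAnomaly

theorem theorem2 (L m : ℕ) (hm : 1 ≤ m) (hmL : m ≤ L) (g f : ℝ → ℝ)
    (hg : MovingAnomaly.IsPdf g) (hf : MovingAnomaly.IsPdf f)
    (γ : ℝ) (hγ : 1 < γ) (b : ℝ) (hb : 0 < b)
    (hMTFA : MovingAnomaly.MTFA (fun _ : Fin L => g)
      (MovingAnomaly.cusumTime (fun _ => g) (fun _ => f) (MovingAnomaly.uniformWeights L m) b)
        = ENNReal.ofReal γ) :
    MovingAnomaly.cusumTime (fun _ => g) (fun _ => f) (MovingAnomaly.uniformWeights L m) b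
        ∈ MovingAnomaly.stoppingClass (fun _ : Fin L => g) γ ∧
      MovingAnomaly.WADD (fun _ : Fin L => g) (fun _ => f) m
        (MovingAnomaly.cusumTime (fun _ => g) (fun _ => f) (MovingAnomaly.uniformWeights L m) b)
      = ⨅ τ ∈ MovingAnomaly.stoppingClass (fun _ : Fin L => g) γ,
          MovingAnomaly.WADD (fun _ : Fin L => g) (fun _ => f) m τ := by
  have hB : 1 ≤ ENNReal.ofReal (Real.exp b) :=
    ENNReal.one_le_ofReal.2 (Real.one_le_exp hb.le)
  have hmem : MovingAnomaly.cusumTime (fun _ => g) (fun _ => f)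
      (MovingAnomaly.uniformWeights L m) b ∈ MovingAnomaly.stoppingClass (fun _ : Fin L => g) γ :=
    ⟨MovingAnomaly.isStoppingTime_cusumTime (fun _ => hg.measurable) (fun _ => hf.measurable) b,
      MovingAnomaly.one_le_cusumTime b, hMTFA.ge⟩
  refine ⟨hmem, le_antisymm (le_iInf₂ fun τ hτ => ?_) (iInf₂_le _ hmem)⟩
  obtain ⟨E, -, hE⟩ := Finset.exists_subset_card_eq
    (show m ≤ (Finset.univ : Finset (Fin L)).card by simpa using hmL)
  have ha := (MovingAnomaly.MTFA_cusumTime (L := L) (m := m) hg hf b).symm.trans hMTFA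
  exact (MovingAnomaly.WADD_cusumTime_le hg hf b ⟨E, hE⟩).trans
    (MovingAnomaly.meanRunLength_le_WADD hmL hg hf hτ.1 hτ.2.1 ⟨E, hE⟩ hB ENNReal.ofReal_ne_top
      (ha ▸ ENNReal.ofReal_ne_top) (ha.le.trans hτ.2.2))
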